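/- For $\alpha\in(0,1)$ and a function $f:\mathbb{R}^2\to\mathbb{C}$, where $\mathbb{R}^2$ is identified with $\mathbb{C}$, put $$\|f\|_{\Lambda_\alpha(\mathbb{R}^2)}=\sup_{z_1\ne z_2}\frac{|f(z_1)-f(z_2)|}{|z_1-z_2|^\alpha},$$ and let $\Lambda_\alpha(\mathbb{R}^2)$ be the class of all $f$ with $\|f\|_{\Lambda_\alpha(\mathbb{R}^2)}<\infty$. A normal operator on a complex Hilbert space is a densely defined closed, not necessarily bounded, operator $N$ with $N^*N=NN^*$, and $f(N)=\int_{\mathbb{C}} f\,dE_N$, where $E_N$ is the spectral measure of $N$; the domain of $f(N)$ is $\{x:\int_{\mathbb{C}}|f|^2\,d(E_Nx,x)<\infty\}$. For operators $A$ and $B$ in a Hilbert space, $\|A-B\|$ is the norm of $A-B$ on the common domain if the domains of $A$ and $B$ coincide and $A-B$ is bounded there, and $\|A-B\|=\infty$ otherwise. There exists a positive number $c$ such that for every $\alpha\in(0,1)$, every $f\in\Lambda_\alpha(\mathbb{R}^2)$, and arbitrary (not necessarily bounded) normal operators $N_1$ and $N_2$ on the same complex Hilbert space, $$\|f(N_1)-f(N_2)\|\le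 c\,(1-\alpha)^{-1}\,\|f\|_{\Lambda_\alpha(\mathbb{R}^2)}\,\|N_1-N_2\|^\alpha,$$ where the right-hand side is read as $0$ if $\|f\|_{\Lambda_\alpha(\mathbb{R}^2)}=0$ and $\|N_1-N_2\|=\infty$. In particular, if $\|N_1-N_2\|<\infty$, then $f(N_1)$ and $f(N_2)$ have the same domain and their difference is bounded on it. -/

import Mathlib

open MeasureTheory Filter Topology
open scoped ENNReal InnerProductSpace LinearPMap

noncomputable section

/-- The Hölder seminorm `sup_{z₁ ≠ z₂} |f z₁ - f z₂| / |z₁ - z₂| ^ α` of a function on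
the plane `ℝ² = ℂ`, with values in `[0, ∞]`. -/
def holderSeminorm (α : ℝ) (f : ℂ → ℂ) : ℝ≥0∞ :=
  ⨆ (z₁ : ℂ) (z₂ : ℂ) (_ : z₁ ≠ z₂), ENNReal.ofReal (‖f z₁ - f z₂‖ / ‖z₁ - z₂‖ ^ α)

/-- Membership in the Hölder class `Λ_α(ℝ²)`. -/
def MemHolderClass (α : ℝ) (f : ℂ → ℂ) : Prop :=
  holderSeminorm α f < ∞

theorem MemHolderClass.measurable {α : ℝ} {f : ℂ → ℂ} (hf : MemHolderClass α f) (hα : 0 < α) :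
    Measurable f := by
  have key : ∀ z₁ z₂, ‖f z₁ - f z₂‖ ≤ (holderSeminorm α f).toReal * ‖z₁ - z₂‖ ^ α := by
    intro z₁ z₂
    by_cases h : z₁ = z₂
    · subst h; simp [Real.zero_rpow hα.ne']
    · have h1 : ENNReal.ofReal (‖f z₁ - f z₂‖ / ‖z₁ - z₂‖ ^ α) ≤ holderSeminorm α f :=
        le_iSup_of_le z₁ (le_iSup_of_le z₂ (le_iSup_of_le h le_rfl))
      have h2 : 0 < ‖z₁ - z₂‖ ^ α := Real.rpow_pos_of_pos (norm_pos_iff.2 (sub_ne_zero.2 h)) _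
      rw [← div_le_iff₀ h2]
      exact (ENNReal.ofReal_le_iff_le_toReal hf.ne).1 h1
  refine Continuous.measurable (continuous_iff_continuousAt.2 fun z => ?_)
  refine tendsto_iff_norm_sub_tendsto_zero.2 ?_
  have hlim : Tendsto (fun w : ℂ => (holderSeminorm α f).toReal * ‖w - z‖ ^ α) (𝓝 z) (𝓝 0) := by
    have hc : Continuous fun w : ℂ => (holderSeminorm α f).toReal * ‖w - z‖ ^ α :=
      continuous_const.mul
        ((continuous_id.sub continuous_const).norm.rpow_const fun _ => Or.inr hα.le)
    simpa [Real.zero_rpow hα.ne'] using hc.tendsto z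
  exact squeeze_zero (fun _ => norm_nonneg _) (fun w => key w z) hlim

section Operators

variable {H : Type*} [NormedAddCommGroup H] [InnerProductSpace ℂ H]

open Classical in
/-- `‖A - B‖` for (possibly unbounded) operators: it is `∞` unless the domains of `A` and `B`
coincide and `A - B` is bounded on the common domain, in which case it is the operator norm
of `A - B` on that domain. -/
def opNormSub (A B : H →ₗ.[ℂ] H) : ℝ≥0∞ :=
  if A.domain = B.domain then ⨆ x : (A - B).domain, ‖(A - B) x‖ₑ / ‖(x : H)‖ₑ else ∞

/-- A (not necessarily bounded) normal operator: a densely defined closed operator `N` such that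
`N* N = N N*`, with equality of domains. -/
structure IsNormalOperator [CompleteSpace H] (N : H →ₗ.[ℂ] H) : Prop where
  dense_domain : Dense (N.domain : Set H)
  isClosed : N.IsClosed
  comm : ∀ x z : H, (∃ y, (x, y) ∈ N.graph ∧ (y, z) ∈ N†.graph) ↔
    (∃ y, (x, y) ∈ N†.graph ∧ (y, z) ∈ N.graph)

end Operators

/-- A spectral measure on the Borel sets of `ℂ`: a projection-valued measure, countably additive
in the strong operator topology. -/
structure SpectralMeasure (H : Type*) [NormedAddCommGroup H] [InnerProductSpace ℂ H]
    [CompleteSpace H] where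
  /-- The projection attached to a Borel set (values at other sets are irrelevant). -/
  proj : Set ℂ → H →L[ℂ] H
  isStarProjection : ∀ S, MeasurableSet S → IsStarProjection (proj S)
  proj_univ : proj Set.univ = 1
  proj_inter : ∀ S T, MeasurableSet S → MeasurableSet T → proj (S ∩ T) = proj S * proj T
  hasSum_proj : ∀ S : ℕ → Set ℂ, (∀ n, MeasurableSet (S n)) →
    Pairwise (Function.onFun Disjoint S) →
    ∀ x : H, HasSum (fun n => proj (S n) x) (proj (⋃ n, S n) x)

namespace SpectralMeasure

variable {H : Type*} [NormedAddCommGroup H] [InnerProductSpace ℂ H] [CompleteSpace H]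
variable (E : SpectralMeasure H)

theorem proj_empty : E.proj ∅ = 0 := by
  ext x
  have h := (E.hasSum_proj (fun _ => ∅) (fun _ => MeasurableSet.empty)
    (fun _ _ _ => by simp [Function.onFun]) x).summable
  simpa using (summable_const_iff _).1 h

theorem inner_proj_right {S : Set ℂ} (hS : MeasurableSet S) (x y : H) :
    ⟪x, E.proj S y⟫_ℂ = ⟪E.proj S x, E.proj S y⟫_ℂ := by
  have h := E.isStarProjection S hS
  have h1 : E.proj S (E.proj S y) = E.proj S y := by
    have := congrArg (fun T : H →L[ℂ] H => T y) h.isIdempotentElem.eq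
    simpa using this
  have h2 : ContinuousLinearMap.adjoint (E.proj S) = E.proj S := h.isSelfAdjoint.star_eq
  calc ⟪x, E.proj S y⟫_ℂ = ⟪x, E.proj S (E.proj S y)⟫_ℂ := by rw [h1]
    _ = ⟪ContinuousLinearMap.adjoint (E.proj S) x, E.proj S y⟫_ℂ := by
        rw [ContinuousLinearMap.adjoint_inner_left]
    _ = _ := by rw [h2]

theorem norm_proj_sq {S : Set ℂ} (hS : MeasurableSet S) (x : H) :
    ‖E.proj S x‖ ^ 2 = RCLike.re ⟪x, E.proj S x⟫_ℂ := by
  rw [E.inner_proj_right hS, inner_self_eq_norm_sq]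

theorem inner_proj_of_disjoint {S T : Set ℂ} (hS : MeasurableSet S) (hT : MeasurableSet T)
    (hST : Disjoint S T) (x y : H) : ⟪E.proj S x, E.proj T y⟫_ℂ = 0 := by
  have h2 : ContinuousLinearMap.adjoint (E.proj S) = E.proj S :=
    (E.isStarProjection S hS).isSelfAdjoint.star_eq
  have h3 : E.proj S (E.proj T y) = 0 := by
    have := E.proj_inter S T hS hT
    rw [hST.inter_eq, E.proj_empty] at this
    simpa using (congrArg (fun A : H →L[ℂ] H => A y) this).symm
  rw [← h2, ContinuousLinearMap.adjoint_inner_left, h3, inner_zero_right]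

/-- The scalar measure `S ↦ ‖E(S) x‖² = ⟪E(S) x, x⟫`. -/
def scalarMeasure (x : H) : Measure ℂ :=
  Measure.ofMeasurable (fun S _ => ‖E.proj S x‖ₑ ^ 2) (by simp [E.proj_empty]) (by
    intro S hS hd
    have h := E.hasSum_proj S hS hd x
    have h1 : HasSum (fun n => ‖E.proj (S n) x‖ ^ 2) (‖E.proj (⋃ n, S n) x‖ ^ 2) := by
      rw [E.norm_proj_sq (MeasurableSet.iUnion hS)]
      simp_rw [fun n => E.norm_proj_sq (hS n) x]
      exact (h.mapL (innerSL ℂ x)).mapL RCLike.reCLM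
    have h2 : ∀ T : Set ℂ, ‖E.proj T x‖ₑ ^ 2 = ENNReal.ofReal (‖E.proj T x‖ ^ 2) := fun T => by
      rw [ENNReal.ofReal_pow (norm_nonneg _), ofReal_norm]
    simp_rw [h2]
    rw [← h1.tsum_eq]
    exact ENNReal.ofReal_tsum_of_nonneg (fun _ => by positivity) h1.summable)

theorem scalarMeasure_apply (x : H) {S : Set ℂ} (hS : MeasurableSet S) :
    E.scalarMeasure x S = ‖E.proj S x‖ₑ ^ 2 :=
  Measure.ofMeasurable_apply S hS

/-- The integral `∑ c • E(s = c)` of a simple function. -/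
def simpleIntegral (s : SimpleFunc ℂ ℂ) : H →L[ℂ] H :=
  ∑ c ∈ s.range, c • E.proj (s ⁻¹' {c})

theorem proj_union {S T : Set ℂ} (hS : MeasurableSet S) (hT : MeasurableSet T)
    (hST : Disjoint S T) (x : H) : E.proj (S ∪ T) x = E.proj S x + E.proj T x := by
  classical
  let v : VectorMeasure ℂ H :=
    { measureOf' := fun A => if MeasurableSet A then E.proj A x else 0
      empty' := by simp [E.proj_empty]
      not_measurable' := fun A hA => by simp [hA]
      m_iUnion' := fun A hA hd => by
        simp only [hA, MeasurableSet.iUnion hA, if_true]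
        exact E.hasSum_proj A hA hd x }
  have hv : ∀ A, MeasurableSet A → v A = E.proj A x := fun A hA => if_pos hA
  rw [← hv _ (hS.union hT), ← hv _ hS, ← hv _ hT]
  exact VectorMeasure.of_union hST hS hT

instance (x : H) : IsFiniteMeasure (E.scalarMeasure x) :=
  ⟨by rw [E.scalarMeasure_apply x MeasurableSet.univ]; exact ENNReal.pow_lt_top enorm_lt_top⟩

theorem simpleIntegral_sub (s t : SimpleFunc ℂ ℂ) (x : H) :
    E.simpleIntegral (s - t) x = E.simpleIntegral s x - E.simpleIntegral t x := by
  let T : Set ℂ → ℂ →L[ℝ] H := fun S =>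
    (ContinuousLinearMap.toSpanSingleton ℂ (E.proj S x)).restrictScalars ℝ
  have hT : FinMeasAdditive (E.scalarMeasure x) T := by
    intro S S' hS hS' _ _ hd
    ext c
    simp [T, E.proj_union hS hS' hd x]
  have h : ∀ r : SimpleFunc ℂ ℂ, E.simpleIntegral r x = r.setToSimpleFunc T := fun r => by
    simp [simpleIntegral, SimpleFunc.setToSimpleFunc, T]
  rw [h, h, h]
  exact SimpleFunc.setToSimpleFunc_sub T hT (SimpleFunc.integrable_of_isFiniteMeasure s)
    (SimpleFunc.integrable_of_isFiniteMeasure t)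

theorem enorm_simpleIntegral_sq (s : SimpleFunc ℂ ℂ) (x : H) :
    ‖E.simpleIntegral s x‖ₑ ^ 2 = ∫⁻ z, ‖s z‖ₑ ^ 2 ∂E.scalarMeasure x := by
  have h1 : ‖E.simpleIntegral s x‖ ^ 2 =
      ∑ c ∈ s.range, ‖c • E.proj (s ⁻¹' {c}) x‖ ^ 2 := by
    have h0 : E.simpleIntegral s x = ∑ c ∈ s.range, c • E.proj (s ⁻¹' {c}) x := by
      simp [simpleIntegral]
    rw [h0, ← inner_self_eq_norm_sq (𝕜 := ℂ), sum_inner, map_sum]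
    refine Finset.sum_congr rfl fun c hc => ?_
    rw [inner_sum, Finset.sum_eq_single c]
    · exact inner_self_eq_norm_sq _
    · intro d _ hdc
      rw [inner_smul_left, inner_smul_right, E.inner_proj_of_disjoint
        (s.measurableSet_fiber c) (s.measurableSet_fiber d), mul_zero, mul_zero]
      exact Disjoint.preimage _ (Set.disjoint_singleton.2 hdc.symm)
    · exact fun h => absurd hc h
  have h2 : ∫⁻ z, ‖s z‖ₑ ^ 2 ∂E.scalarMeasure x =
      ∑ c ∈ s.range, ‖c‖ₑ ^ 2 * ‖E.proj (s ⁻¹' {c}) x‖ₑ ^ 2 := by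
    have := SimpleFunc.map_lintegral (μ := E.scalarMeasure x) (fun c : ℂ => ‖c‖ₑ ^ 2) s
    rw [← SimpleFunc.lintegral_eq_lintegral] at this
    simp only [SimpleFunc.coe_map, Function.comp_apply] at this
    rw [this]
    exact Finset.sum_congr rfl fun c _ => by
      rw [E.scalarMeasure_apply x (s.measurableSet_fiber c)]
  have h3 : ∀ y : H, ‖y‖ₑ ^ 2 = ENNReal.ofReal (‖y‖ ^ 2) := fun y => by
    rw [ENNReal.ofReal_pow (norm_nonneg _), ofReal_norm]
  rw [h2, h3, h1, ENNReal.ofReal_sum_of_nonneg fun _ _ => by positivity]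
  exact Finset.sum_congr rfl fun c _ => by rw [← h3, enorm_smul, mul_pow]

/-- A sequence of simple functions converging to `f` pointwise, with `|s_n| ≤ 2 |f|`. -/
def approx (f : ℂ → ℂ) (hf : Measurable f) (n : ℕ) : SimpleFunc ℂ ℂ :=
  SimpleFunc.approxOn f hf Set.univ 0 (Set.mem_univ 0) n

theorem enorm_simpleIntegral (s : SimpleFunc ℂ ℂ) (x : H) :
    ‖E.simpleIntegral s x‖ₑ = eLpNorm s 2 (E.scalarMeasure x) := by
  rw [eLpNorm_eq_lintegral_rpow_enorm_toReal (by simp) (by simp)]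
  simp only [ENNReal.toReal_ofNat, ENNReal.rpow_ofNat]
  rw [← E.enorm_simpleIntegral_sq, ← ENNReal.rpow_natCast, ← ENNReal.rpow_mul]
  norm_num

theorem exists_tendsto_simpleIntegral {f : ℂ → ℂ} (hf : Measurable f) {x : H}
    (hx : MemLp f 2 (E.scalarMeasure x)) :
    ∃ y, Tendsto (fun n => E.simpleIntegral (approx f hf n) x) atTop (𝓝 y) := by
  have hlim : Tendsto (fun n => eLpNorm (⇑(approx f hf n) - f) 2 (E.scalarMeasure x))
      atTop (𝓝 0) :=
    SimpleFunc.tendsto_approxOn_Lp_eLpNorm hf _ (by simp) (by simp) (by simpa using hx.2)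
  refine cauchySeq_tendsto_of_complete (EMetric.cauchySeq_iff.2 fun ε hε => ?_)
  obtain ⟨n₀, hn₀⟩ := eventually_atTop.1
    ((ENNReal.tendsto_nhds_zero.1 hlim) (ε / 3) (by simpa using hε.ne'))
  by_cases hεt : ε = ∞
  · exact ⟨0, fun m _ n _ => by rw [hεt]; exact edist_lt_top _ _⟩
  refine ⟨n₀, fun m hm n hn => ?_⟩
  rw [edist_eq_enorm_sub, ← E.simpleIntegral_sub, E.enorm_simpleIntegral]
  have haes : ∀ k, AEStronglyMeasurable (⇑(approx f hf k) - f) (E.scalarMeasure x) := fun k =>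
    ((approx f hf k).measurable.sub hf).aestronglyMeasurable
  have hsub : ⇑(approx f hf m - approx f hf n) =
      (⇑(approx f hf m) - f) - (⇑(approx f hf n) - f) := by
    rw [SimpleFunc.coe_sub]; abel
  rw [hsub]
  refine (eLpNorm_sub_le (haes m) (haes n) (by norm_num)).trans_lt ?_
  refine (add_le_add (hn₀ m hm) (hn₀ n hn)).trans_lt ?_
  calc ε / 3 + ε / 3 < ε / 3 + ε / 3 + ε / 3 :=
        ENNReal.lt_add_right (by finiteness) (by simpa using hε.ne')
    _ = ε := ENNReal.add_thirds ε

theorem scalarMeasure_add_le (x y : H) :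
    E.scalarMeasure (x + y) ≤ (2 : ℝ≥0∞) • (E.scalarMeasure x + E.scalarMeasure y) := by
  refine Measure.le_iff.2 fun S hS => ?_
  rw [Measure.smul_apply, Measure.add_apply, E.scalarMeasure_apply _ hS,
    E.scalarMeasure_apply _ hS, E.scalarMeasure_apply _ hS, map_add, smul_eq_mul]
  have h3 : ∀ y : H, ‖y‖ₑ ^ 2 = ENNReal.ofReal (‖y‖ ^ 2) := fun y => by
    rw [ENNReal.ofReal_pow (norm_nonneg _), ofReal_norm]
  rw [h3, h3, h3, ← ENNReal.ofReal_add (by positivity) (by positivity),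
    ← ENNReal.ofReal_ofNat, ← ENNReal.ofReal_mul (by norm_num)]
  refine ENNReal.ofReal_le_ofReal ?_
  have h := norm_add_le (E.proj S x) (E.proj S y)
  nlinarith [norm_nonneg (E.proj S x + E.proj S y), sq_nonneg (‖E.proj S x‖ - ‖E.proj S y‖)]

theorem scalarMeasure_smul (c : ℂ) (x : H) :
    E.scalarMeasure (c • x) = ‖c‖ₑ ^ 2 • E.scalarMeasure x := by
  refine Measure.ext fun S hS => ?_
  rw [Measure.smul_apply, E.scalarMeasure_apply _ hS, E.scalarMeasure_apply _ hS, map_smul,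
    enorm_smul, mul_pow, smul_eq_mul]

/-- The (in general unbounded) operator `∫ f dE` for a Borel function `f`. Its domain consists of
all `x` with `∫ |f|² d⟪E x, x⟫ < ∞`, and `(∫ f dE) x` is the limit of `(∫ s_n dE) x` for simple
functions `s_n` that converge to `f` pointwise with `|s_n| ≤ 2 |f|`, hence in
`L²(⟪E x, x⟫)`. -/
def integral (f : ℂ → ℂ) (hf : Measurable f) : H →ₗ.[ℂ] H where
  domain :=
    { carrier := {x | MemLp f 2 (E.scalarMeasure x)}
      zero_mem' := by
        have h : E.scalarMeasure 0 = 0 := Measure.ext fun S hS => by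
          rw [E.scalarMeasure_apply _ hS]; simp
        simp [h]
      add_mem' := fun {x y} hx hy => by
        have hxy : MemLp f 2 (E.scalarMeasure x + E.scalarMeasure y) := by
          refine ⟨hf.aestronglyMeasurable, ?_⟩
          have h : ∀ μ : Measure ℂ, eLpNorm f 2 μ < ∞ ↔ ∫⁻ z, ‖f z‖ₑ ^ (2 : ℝ) ∂μ < ∞ := fun μ => by
            simpa using eLpNorm_lt_top_iff_lintegral_rpow_enorm_lt_top
              (f := f) (μ := μ) (p := 2) (by simp) (by simp)
          rw [h, lintegral_add_measure, ENNReal.add_lt_top]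
          exact ⟨(h _).1 hx.2, (h _).1 hy.2⟩
        exact (hxy.smul_measure (by simp)).mono_measure (E.scalarMeasure_add_le x y)
      smul_mem' := fun c x hx => by
        simp only [Set.mem_ofPred_eq, E.scalarMeasure_smul]
        exact MemLp.smul_measure hx (by finiteness) }
  toFun :=
    { toFun := fun x => (E.exists_tendsto_simpleIntegral hf x.2).choose
      map_add' := fun x y => by
        refine tendsto_nhds_unique (E.exists_tendsto_simpleIntegral hf (x + y).2).choose_spec ?_
        simpa using (E.exists_tendsto_simpleIntegral hf x.2).choose_spec.add
          (E.exists_tendsto_simpleIntegral hf y.2).choose_spec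
      map_smul' := fun c x => by
        refine tendsto_nhds_unique (E.exists_tendsto_simpleIntegral hf (c • x).2).choose_spec ?_
        simpa using (E.exists_tendsto_simpleIntegral hf x.2).choose_spec.const_smul c }

end SpectralMeasure

open Classical in
/-- The function `f(N) = ∫ f dE` of a normal operator `N`, where `E` is the spectral measure of
`N`, i.e. the spectral measure on `ℂ` with `N = ∫ z dE(z)` (it exists and is unique by
the spectral theorem). The value `⊥` is never attained at a normal operator. -/
def borelFunction {H : Type*} [NormedAddCommGroup H] [InnerProductSpace ℂ H] [CompleteSpace H]
    (N : H →ₗ.[ℂ] H) (f : ℂ → ℂ) (hf : Measurable f) : H →ₗ.[ℂ] H :=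
  if h : ∃ E : SpectralMeasure H, N = E.integral (fun z => z) measurable_id
  then h.choose.integral f hf else ⊥

end

/-!
Round the spectral measures of `N₁` and `N₂` to the square lattice of mesh `δ = ‖N₁ - N₂‖`; since
`f` is Hölder continuous, this changes `f(N₁)` and `f(N₂)` by `O(‖f‖ δ ^ α)`, and it changes `N₁`
and `N₂` by `O(δ)`. For the lattice operators with spectral projections `P k` and `Q l`, the
difference `f(N₁) - f(N₂)` has the blocks `(f k - f l) • P k Q l`, and `f k - f l` is a combination
of the coordinate differences of `k` and `l`, weighted by divided differences of `f` in one integer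
variable; the coordinate differences are carried by the real and imaginary parts of `N₁ - N₂`.

These divided differences are bounded Schur multipliers. With the second variable rounded to blocks
of length `2 ^ n`, they telescope over `n`; the terms of the telescoping sum decay fast enough away
from the diagonal to have multiplier norm `O(2 ^ (n (α - 1)))` by Cauchy–Schwarz, and the geometric
series produces `(1 - α)⁻¹`.

The spectral theorem reduces to the commuting bounded operators `(1 + N†N)⁻¹` and `N (1 + N†N)⁻¹`,
which generate a commutative C⋆-algebra `C(X)`; the spectral measure is the image under the quotient
of these two functions of the measures that the Riesz–Markov theorem provides on `X`.
-/

noncomputable section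

open ComplexConjugate NNReal

/-! ### Schur multipliers and divided differences -/

section SchurMultiplier

variable {ι κ ν : Type*} {H : Type*} [NormedAddCommGroup H] [InnerProductSpace ℂ H]

theorem norm_sum_smul_sq {p : ι → H} (hp : Pairwise fun i j => ⟪p i, p j⟫_ℂ = 0)
    (S : Finset ι) (a : ι → ℂ) :
    ‖∑ i ∈ S, a i • p i‖ ^ 2 = ∑ i ∈ S, ‖a i‖ ^ 2 * ‖p i‖ ^ 2 := by
  rw [← inner_self_eq_norm_sq (𝕜 := ℂ), sum_inner, map_sum]
  refine Finset.sum_congr rfl fun i hi => ?_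
  rw [inner_sum, Finset.sum_eq_single_of_mem i hi fun j _ hji => ?_, inner_self_eq_norm_sq,
    norm_smul, mul_pow]
  rw [inner_smul_left, inner_smul_right, hp hji.symm, mul_zero, mul_zero]

theorem norm_sum_sq {p : ι → H} (hp : Pairwise fun i j => ⟪p i, p j⟫_ℂ = 0) (S : Finset ι) :
    ‖∑ i ∈ S, p i‖ ^ 2 = ∑ i ∈ S, ‖p i‖ ^ 2 := by
  simpa using norm_sum_smul_sq hp S 1

variable (H) in
/-- `m` is a Schur multiplier on `B(H)` with constant `C`: multiplying the matrix of a bounded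
operator entrywise by `m` increases its norm by at most the factor `C`. The matrix is taken
between two finite orthogonal families, which need not be normalized. -/
def IsSchurMultiplier (m : ι → κ → ℂ) (C : ℝ) : Prop :=
  ∀ (S : Finset ι) (T : Finset κ) (p : ι → H) (q : κ → H),
    (Pairwise fun i j => ⟪p i, p j⟫_ℂ = 0) → (Pairwise fun i j => ⟪q i, q j⟫_ℂ = 0) →
    ∀ K : H →L[ℂ] H, ‖∑ i ∈ S, ∑ j ∈ T, m i j * ⟪p i, K (q j)⟫_ℂ‖ ≤
      C * (‖K‖ * √(∑ i ∈ S, ‖p i‖ ^ 2) * √(∑ j ∈ T, ‖q j‖ ^ 2))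

namespace IsSchurMultiplier

/-- Columns with the same label `β j` are merged, and Cauchy–Schwarz is applied to the sum over
the labels. -/
theorem of_sum_sq_le {a : ι → ν → ℂ} {A : ℝ} (hA : 0 ≤ A)
    (ha : ∀ i (F : Finset ν), ∑ n ∈ F, ‖a i n‖ ^ 2 ≤ A ^ 2) (β : κ → ν) :
    IsSchurMultiplier H (fun i j => a i (β j)) A := by
  classical
  intro S T p q hp hq K
  let x : ν → H := fun n => ∑ i ∈ S, conj (a i n) • p i
  let y : ν → H := fun n => ∑ j ∈ T with β j = n, q j
  have hsum : ∑ i ∈ S, ∑ j ∈ T, a i (β j) * ⟪p i, K (q j)⟫_ℂ =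
      ∑ n ∈ T.image β, ⟪x n, K (y n)⟫_ℂ := by
    simp only [x, y, sum_inner, map_sum, inner_sum, inner_smul_left, RCLike.conj_conj]
    rw [Finset.sum_comm, ← Finset.sum_fiberwise_of_maps_to fun j => Finset.mem_image_of_mem β]
    refine Finset.sum_congr rfl fun n _ => ?_
    refine Finset.sum_congr rfl fun j hj => Finset.sum_congr rfl fun i _ => ?_
    rw [(Finset.mem_filter.1 hj).2]
  have hx : ∑ n ∈ T.image β, ‖x n‖ ^ 2 ≤ A ^ 2 * ∑ i ∈ S, ‖p i‖ ^ 2 := by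
    simp only [x, norm_sum_smul_sq hp, RCLike.norm_conj]
    rw [Finset.sum_comm, Finset.mul_sum]
    simp only [← Finset.sum_mul]
    gcongr with i
    exact ha i _
  have hy : ∑ n ∈ T.image β, ‖y n‖ ^ 2 = ∑ j ∈ T, ‖q j‖ ^ 2 := by
    simp only [y, norm_sum_sq hq]
    exact Finset.sum_fiberwise_of_maps_to (fun j => Finset.mem_image_of_mem β) _
  calc ‖∑ i ∈ S, ∑ j ∈ T, a i (β j) * ⟪p i, K (q j)⟫_ℂ‖
      ≤ ∑ n ∈ T.image β, ‖K‖ * (‖x n‖ * ‖y n‖) := by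
        rw [hsum]
        refine norm_sum_le_of_le _ fun n _ => (norm_inner_le_norm _ _).trans ?_
        rw [mul_left_comm]
        gcongr
        exact K.le_opNorm _
    _ ≤ ‖K‖ * (√(∑ n ∈ T.image β, ‖x n‖ ^ 2) * √(∑ n ∈ T.image β, ‖y n‖ ^ 2)) := by
        rw [← Finset.mul_sum]
        gcongr
        exact Real.sum_mul_le_sqrt_mul_sqrt _ _ _
    _ ≤ ‖K‖ * (A * √(∑ i ∈ S, ‖p i‖ ^ 2) * √(∑ j ∈ T, ‖q j‖ ^ 2)) := by
        rw [hy]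
        gcongr
        refine (Real.sqrt_le_sqrt hx).trans_eq ?_
        rw [Real.sqrt_mul (sq_nonneg A), Real.sqrt_sq hA]
    _ = A * (‖K‖ * √(∑ i ∈ S, ‖p i‖ ^ 2) * √(∑ j ∈ T, ‖q j‖ ^ 2)) := by ring

theorem mono {m : ι → κ → ℂ} {C D : ℝ} (hm : IsSchurMultiplier H m C) (hCD : C ≤ D) :
    IsSchurMultiplier H m D := fun S T p q hp hq K =>
  (hm S T p q hp hq K).trans (by gcongr)

theorem sum {m : ν → ι → κ → ℂ} {C : ν → ℝ} (F : Finset ν)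
    (hm : ∀ n ∈ F, IsSchurMultiplier H (m n) (C n)) :
    IsSchurMultiplier H (fun i j => ∑ n ∈ F, m n i j) (∑ n ∈ F, C n) := by
  intro S T p q hp hq K
  simp only [Finset.sum_mul]
  calc ‖∑ i ∈ S, ∑ j ∈ T, ∑ n ∈ F, m n i j * ⟪p i, K (q j)⟫_ℂ‖
      = ‖∑ n ∈ F, ∑ i ∈ S, ∑ j ∈ T, m n i j * ⟪p i, K (q j)⟫_ℂ‖ := by
        simp only [Finset.sum_comm (s := F)]
    _ ≤ _ := norm_sum_le_of_le _ fun n hn => hm n hn S T p q hp hq K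

theorem of_tendsto {l : Filter ν} [l.NeBot] {m : ν → ι → κ → ℂ} {M : ι → κ → ℂ} {C : ℝ}
    (hm : ∀ n, IsSchurMultiplier H (m n) C)
    (hM : ∀ i j, Tendsto (fun n => m n i j) l (𝓝 (M i j))) : IsSchurMultiplier H M C :=
  fun S T p q hp hq K => le_of_tendsto
    (tendsto_finsetSum S fun i _ => tendsto_finsetSum T fun j _ => (hM i j).mul_const _).norm
    (Eventually.of_forall fun n => hm n S T p q hp hq K)

theorem conjTranspose [CompleteSpace H] {m : ι → κ → ℂ} {C : ℝ} (hm : IsSchurMultiplier H m C) :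
    IsSchurMultiplier H (fun j i => conj (m i j)) C := by
  intro T S q p hq hp K
  have h := hm S T p q hp hq (ContinuousLinearMap.adjoint K)
  rw [← RCLike.norm_conj, LinearIsometryEquiv.norm_map, mul_right_comm] at h
  refine h.trans_eq' ?_
  rw [map_sum, Finset.sum_comm]
  simp only [map_sum, map_mul, inner_conj_symm, ContinuousLinearMap.adjoint_inner_left]

end IsSchurMultiplier

end SchurMultiplier

section DyadicDecomposition

variable {α L : ℝ≥0} {u : ℤ → ℂ}

theorem sum_geometric_rpow_le {α : ℝ} (hα₀ : 0 ≤ α) (hα₁ : α < 1) (m : ℕ) :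
    ∑ i ∈ Finset.range m, ((2 : ℝ) ^ (α - 1)) ^ i ≤ 2 * (1 - α)⁻¹ := by
  have hr : (2 : ℝ) ^ (α - 1) ≤ 1 - (1 - α) / 2 := by
    have h := rpow_one_add_le_one_add_mul_self (s := -1 / 2) (by norm_num) (p := 1 - α)
      (by linarith) (by linarith)
    have h2 : (1 + -1 / 2 : ℝ) ^ (1 - α) = 2 ^ (α - 1) := by
      rw [show (1 + -1 / 2 : ℝ) = 2⁻¹ by norm_num, Real.inv_rpow (by norm_num),
        ← Real.rpow_neg (by norm_num), neg_sub]
    linarith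
  have hgeom : ∑ i ∈ Finset.range m, ((2 : ℝ) ^ (α - 1)) ^ i ≤ (1 - (2 : ℝ) ^ (α - 1))⁻¹ := by
    rw [← tsum_geometric_of_lt_one (by positivity) (by linarith)]
    exact (summable_geometric_of_lt_one (by positivity) (by linarith)).sum_le_tsum _
      fun _ _ => by positivity
  calc _ ≤ (1 - (2 : ℝ) ^ (α - 1))⁻¹ := hgeom
    _ ≤ ((1 - α) / 2)⁻¹ := inv_anti₀ (by linarith) (by linarith)
    _ = 2 * (1 - α)⁻¹ := by rw [inv_div, div_eq_mul_inv]

theorem sum_inv_one_add_abs_sq_le (F : Finset ℤ) : ∑ i ∈ F, ((1 + |(i : ℝ)|) ^ 2)⁻¹ ≤ 4 := by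
  have hzeta : HasSum (fun n : ℕ => (((n : ℝ) + 1) ^ 2)⁻¹) (Real.pi ^ 2 / 6) := by
    simpa using (hasSum_nat_add_iff' 1).2 hasSum_zeta_two
  have hzeta_tail : HasSum (fun n : ℕ => (((n : ℝ) + 2) ^ 2)⁻¹) (Real.pi ^ 2 / 6 - 1) := by
    simpa [add_assoc, one_add_one_eq_two] using (hasSum_nat_add_iff' 1).2 hzeta
  have hsum := HasSum.of_nat_of_neg_add_one (f := fun i : ℤ => ((1 + |(i : ℝ)|) ^ 2)⁻¹)
    (by simpa [add_comm] using hzeta) (hzeta_tail.congr_fun fun n => ?_)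
  · refine (sum_le_hasSum F (fun i _ => by positivity) hsum).trans ?_
    nlinarith [Real.pi_lt_d2, Real.pi_pos]
  · rw [← abs_neg]
    push_cast
    rw [neg_neg, abs_of_nonneg (by positivity), add_comm, add_assoc, one_add_one_eq_two]

/-- The divided difference of `u` between `k` and the `j`-th block `[n * j, n * j + n)`, with both
points of the denominator rounded down to multiples of `n`. If `k` lies in the `j`-th block, the
value is the junk value `0`. -/
def blockDivDiff (u : ℤ → ℂ) (n : ℕ) (k j : ℤ) : ℂ :=
  (u k - u (n * j)) / ((n * (k / n - j) : ℤ) : ℂ)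

theorem norm_sub_block_le (hu : HolderWith L α u) (hα : α ≤ 1) {n : ℕ} (hn : 0 < n) {k j : ℤ}
    (hkj : k / n ≠ j) :
    ‖u k - u (n * j)‖ ≤ 2 * L * (n : ℝ) ^ (α : ℝ) * |((k / n - j : ℤ) : ℝ)| := by
  set d : ℤ := |k / n - j| with hd
  have hd1 : 1 ≤ d := Int.one_le_abs (sub_ne_zero.2 hkj)
  have hdist : |k - n * j| ≤ n * (2 * d) := by
    have hn' : (0 : ℤ) < n := by exact_mod_cast hn
    have hsplit : k - n * j = n * (k / n - j) + k % n := by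
      linarith [Int.mul_ediv_add_emod k n]
    calc |k - n * j| ≤ n * d + n := by
          rw [hsplit]
          refine (abs_add_le _ _).trans (add_le_add ?_ ?_)
          · rw [abs_mul, abs_of_pos hn']
          · rw [abs_of_nonneg (Int.emod_nonneg _ hn'.ne')]
            exact (Int.emod_lt_of_pos _ hn').le
      _ ≤ n * (2 * d) := by nlinarith
  have hd1' : (1 : ℝ) ≤ 2 * d := by
    have : (1 : ℝ) ≤ d := by exact_mod_cast hd1
    linarith
  calc ‖u k - u (n * j)‖ ≤ L * |((k - n * j : ℤ) : ℝ)| ^ (α : ℝ) := by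
        simpa [Int.dist_eq, dist_eq_norm, Int.norm_eq_abs] using hu.dist_le k (n * j)
    _ ≤ L * (n * (2 * d) : ℝ) ^ (α : ℝ) := by
        gcongr
        exact_mod_cast hdist
    _ ≤ L * ((n : ℝ) ^ (α : ℝ) * (2 * d)) := by
        rw [Real.mul_rpow (by positivity) (by positivity)]
        gcongr
        exact Real.rpow_le_self_of_one_le hd1' (by exact_mod_cast hα)
    _ = 2 * L * (n : ℝ) ^ (α : ℝ) * |((k / n - j : ℤ) : ℝ)| := by
        rw [hd]; push_cast; ring

theorem norm_natCast_mul_intCast (n : ℕ) (a : ℤ) : ‖((n * a : ℤ) : ℂ)‖ = n * |(a : ℝ)| := by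
  rw [Complex.norm_intCast, Int.cast_mul, abs_mul, Int.cast_natCast, Nat.abs_cast]

theorem ediv_two_mul (k : ℤ) (n : ℕ) : k / ((2 * n : ℕ) : ℤ) = k / n / 2 := by
  rw [Nat.mul_comm, Nat.cast_mul, Int.ediv_ediv_of_nonneg n.cast_nonneg, Nat.cast_two]

theorem norm_div_sub_div_le {a b s t : ℂ} (hs : s ≠ 0) (ht : t ≠ 0) :
    ‖a / s - b / t‖ ≤ ‖a‖ * ‖t - s‖ / (‖s‖ * ‖t‖) + ‖a - b‖ / ‖t‖ := by
  have h : a / s - b / t = a * (t - s) / (s * t) + (a - b) / t := by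
    field_simp
    ring
  rw [h, ← norm_mul, ← norm_mul, ← norm_div, ← norm_div]
  exact norm_add_le _ _

theorem norm_blockDivDiff_le (hu : HolderWith L α u) (hα : α ≤ 1) {n : ℕ} (hn : 0 < n)
    (k j : ℤ) : ‖blockDivDiff u n k j‖ ≤ 2 * L * ((n : ℝ) ^ (α : ℝ) / n) := by
  rcases eq_or_ne (k / n) j with h | h
  · simp only [blockDivDiff, h, sub_self, mul_zero, Int.cast_zero, div_zero, norm_zero]
    positivity
  have : (0 : ℝ) < |((k / n - j : ℤ) : ℝ)| := abs_pos.2 (by exact_mod_cast sub_ne_zero.2 h)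
  calc ‖blockDivDiff u n k j‖ = ‖u k - u (n * j)‖ / (n * |((k / n - j : ℤ) : ℝ)|) := by
        rw [blockDivDiff, norm_div, norm_natCast_mul_intCast]
    _ ≤ 2 * L * (n : ℝ) ^ (α : ℝ) * |((k / n - j : ℤ) : ℝ)| /
          (n * |((k / n - j : ℤ) : ℝ)|) := by
        gcongr
        exact norm_sub_block_le hu hα hn h
    _ = 2 * L * ((n : ℝ) ^ (α : ℝ) / n) := by
        field_simp

theorem norm_sub_parent_block_le (hu : HolderWith L α u) (n : ℕ) (j : ℤ) :
    ‖u ((2 * n : ℕ) * (j / 2)) - u (n * j)‖ ≤ L * (n : ℝ) ^ (α : ℝ) := by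
  have hdist : |(2 * n : ℕ) * (j / 2) - n * j| ≤ n := by
    rw [show (2 * n : ℕ) * (j / 2) - n * j = n * (2 * (j / 2) - j) by push_cast; ring, abs_mul,
      Nat.abs_cast]
    exact mul_le_of_le_one_right n.cast_nonneg (by grind)
  rw [← dist_eq_norm]
  refine (hu.dist_le _ _).trans ?_
  rw [Int.dist_eq]
  gcongr
  exact_mod_cast hdist

theorem norm_blockDivDiff_sub_le_of_ne (hu : HolderWith L α u) (hα : α ≤ 1) {n : ℕ} (hn : 0 < n)
    {k j : ℤ} (hkj : k / n / 2 ≠ j / 2) :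
    ‖blockDivDiff u n k j - blockDivDiff u (2 * n) k (j / 2)‖ ≤
      6 * L * ((n : ℝ) ^ (α : ℝ) / n) / (1 + |((k / n - j : ℤ) : ℝ)|) := by
  set d : ℝ := |((k / n - j : ℤ) : ℝ)| with hd
  set D : ℝ := |((k / n / 2 - j / 2 : ℤ) : ℝ)| with hD
  have hd0 : 0 < d := abs_pos.2 (by norm_cast; grind)
  have hD0 : 0 < D := abs_pos.2 (by norm_cast; grind)
  have hdD : 1 + d ≤ 4 * D := by
    rw [hd, hD]
    norm_cast
    grind
  set s : ℂ := ((n * (k / n - j) : ℤ) : ℂ)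
  set t : ℂ := (((2 * n : ℕ) * (k / n / 2 - j / 2) : ℤ) : ℂ)
  have hs : ‖s‖ = n * d := norm_natCast_mul_intCast _ _
  have ht : ‖t‖ = (2 * n : ℕ) * D := norm_natCast_mul_intCast _ _
  have hts : ‖t - s‖ ≤ n := by
    rw [← Int.cast_sub, show (2 * n : ℕ) * (k / n / 2 - j / 2) - n * (k / n - j) =
      n * (2 * (k / n / 2 - j / 2) - (k / n - j)) by push_cast; ring, norm_natCast_mul_intCast]
    exact mul_le_of_le_one_right n.cast_nonneg (by norm_cast; grind)
  calc ‖blockDivDiff u n k j - blockDivDiff u (2 * n) k (j / 2)‖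
      = ‖(u k - u (n * j)) / s - (u k - u ((2 * n : ℕ) * (j / 2))) / t‖ := by
        rw [blockDivDiff, blockDivDiff, ediv_two_mul]
    _ ≤ ‖u k - u (n * j)‖ * ‖t - s‖ / (‖s‖ * ‖t‖) +
        ‖u ((2 * n : ℕ) * (j / 2)) - u (n * j)‖ / ‖t‖ := by
        refine (norm_div_sub_div_le (norm_pos_iff.1 ?_) (norm_pos_iff.1 ?_)).trans_eq ?_
        · rw [hs]; positivity
        · rw [ht]; positivity
        · rw [sub_sub_sub_cancel_left]
    _ ≤ 2 * L * (n : ℝ) ^ (α : ℝ) * d * n / (n * d * ((2 * n : ℕ) * D)) +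
        L * (n : ℝ) ^ (α : ℝ) / ((2 * n : ℕ) * D) := by
        rw [hs, ht]
        gcongr
        · exact norm_sub_block_le hu hα hn fun h => hkj (by rw [h])
        · exact norm_sub_parent_block_le hu n j
    _ = 6 * L * ((n : ℝ) ^ (α : ℝ) / n) / (4 * D) := by
        push_cast
        field_simp
        ring
    _ ≤ 6 * L * ((n : ℝ) ^ (α : ℝ) / n) / (1 + d) := by gcongr

theorem norm_blockDivDiff_sub_le (hu : HolderWith L α u) (hα : α ≤ 1) {n : ℕ} (hn : 0 < n)
    (k j : ℤ) :
    ‖blockDivDiff u n k j - blockDivDiff u (2 * n) k (j / 2)‖ ≤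
      6 * L * ((n : ℝ) ^ (α : ℝ) / n) / (1 + |((k / n - j : ℤ) : ℝ)|) := by
  rcases ne_or_eq (k / n / 2) (j / 2) with h | h
  · exact norm_blockDivDiff_sub_le_of_ne hu hα hn h
  have hparent : blockDivDiff u (2 * n) k (j / 2) = 0 := by
    rw [blockDivDiff, ediv_two_mul, h, sub_self, mul_zero, Int.cast_zero, div_zero]
  have hd : 1 + |((k / n - j : ℤ) : ℝ)| ≤ 3 := by
    norm_cast; grind
  calc _ ≤ 2 * L * ((n : ℝ) ^ (α : ℝ) / n) := by
        rw [hparent, sub_zero]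
        exact norm_blockDivDiff_le hu hα hn k j
    _ = 6 * L * ((n : ℝ) ^ (α : ℝ) / n) / 3 := by ring
    _ ≤ _ := by gcongr

theorem two_pow_rpow_div (α : ℝ) (m : ℕ) :
    ((2 ^ m : ℕ) : ℝ) ^ α / (2 ^ m : ℕ) = ((2 : ℝ) ^ (α - 1)) ^ m := by
  rw [← Real.rpow_sub_one (by positivity), Nat.cast_pow, Nat.cast_two, ← Real.rpow_natCast,
    ← Real.rpow_natCast, ← Real.rpow_mul two_pos.le, ← Real.rpow_mul two_pos.le, mul_comm]

end DyadicDecomposition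

section HolderDivDiff

variable {ι κ : Type*} {H : Type*} [NormedAddCommGroup H] [InnerProductSpace ℂ H]
  {α L : ℝ≥0} {w : ι → ℤ → ℂ}

theorem isSchurMultiplier_blockDivDiff_sub (hw : ∀ i, HolderWith L α (w i)) (hα : α ≤ 1)
    {n : ℕ} (hn : 0 < n) (e : ι → ℤ) (d : κ → ℤ) :
    IsSchurMultiplier H (fun i j => blockDivDiff (w i) n (e i) (d j / n) -
      blockDivDiff (w i) (2 * n) (e i) (d j / (2 * n : ℕ))) (12 * L * ((n : ℝ) ^ (α : ℝ) / n)) := by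
  simp only [ediv_two_mul]
  refine .of_sum_sq_le (a := fun i l => blockDivDiff (w i) n (e i) l -
    blockDivDiff (w i) (2 * n) (e i) (l / 2)) (by positivity) (fun i F => ?_) fun j => d j / n
  set B : ℝ := 6 * L * ((n : ℝ) ^ (α : ℝ) / n)
  have hF : ∑ l ∈ F, ((1 + |((e i / n - l : ℤ) : ℝ)|) ^ 2)⁻¹ ≤ 4 := by
    simpa [Finset.sum_image fun _ _ _ _ h => sub_right_injective h] using
      sum_inv_one_add_abs_sq_le (F.image (e i / n - ·))
  calc _ ≤ ∑ l ∈ F, (B / (1 + |((e i / n - l : ℤ) : ℝ)|)) ^ 2 := by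
        gcongr with l
        exact norm_blockDivDiff_sub_le (hw i) hα hn _ _
    _ = B ^ 2 * ∑ l ∈ F, ((1 + |((e i / n - l : ℤ) : ℝ)|) ^ 2)⁻¹ := by
        simp only [mul_pow, inv_pow, Finset.mul_sum, div_eq_mul_inv]
    _ ≤ B ^ 2 * 4 := by gcongr
    _ = (12 * L * ((n : ℝ) ^ (α : ℝ) / n)) ^ 2 := by ring

theorem isSchurMultiplier_divDiff (hw : ∀ i, HolderWith L α (w i)) (hα : α < 1)
    (e : ι → ℤ) (d : κ → ℤ) :
    IsSchurMultiplier H (fun i j => (w i (e i) - w i (d j)) / ((e i - d j : ℤ) : ℂ))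
      (24 * (1 - α : ℝ)⁻¹ * L) := by
  have hα' : (α : ℝ) < 1 := by exact_mod_cast hα
  set r : ℝ := 2 ^ ((α : ℝ) - 1)
  have hr : r < 1 := Real.rpow_lt_one_of_one_lt_of_neg one_lt_two (by linarith)
  let b : ℕ → ι → κ → ℂ := fun m i j => blockDivDiff (w i) (2 ^ m) (e i) (d j / (2 ^ m : ℕ))
  have hpartial : ∀ m, IsSchurMultiplier H (fun i j => b 0 i j - b m i j)
      (24 * (1 - α : ℝ)⁻¹ * L) := fun m => by
    have hscale : ∀ n, IsSchurMultiplier H (fun i j => b n i j - b (n + 1) i j)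
        (12 * L * r ^ n) := fun n => by
      have := isSchurMultiplier_blockDivDiff_sub (H := H) hw hα.le (n := 2 ^ n) (by positivity) e d
      rwa [two_pow_rpow_div, ← pow_succ'] at this
    have hsum := IsSchurMultiplier.sum (Finset.range m) fun n _ => hscale n
    simp only [Finset.sum_range_sub', ← Finset.mul_sum] at hsum
    refine hsum.mono ?_
    calc 12 * L * ∑ n ∈ Finset.range m, r ^ n ≤ 12 * L * (2 * (1 - α : ℝ)⁻¹) := by
          gcongr
          exact sum_geometric_rpow_le α.coe_nonneg hα' m
      _ = 24 * (1 - α : ℝ)⁻¹ * L := by ring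
  refine IsSchurMultiplier.of_tendsto (l := atTop) hpartial fun i j => ?_
  have hlim : Tendsto (fun m => b m i j) atTop (𝓝 0) := by
    refine squeeze_zero_norm (a := fun m => 2 * L * r ^ m) (fun m => ?_) ?_
    · rw [← two_pow_rpow_div]
      exact norm_blockDivDiff_le (hw i) hα.le (by positivity) _ _
    · simpa using (tendsto_pow_atTop_nhds_zero_of_lt_one (by positivity) hr).const_mul (2 * (L : ℝ))
  simpa [b, blockDivDiff] using hlim.const_sub (b 0 i j)

theorem isSchurMultiplier_divDiff_right [CompleteSpace H] (hw : ∀ i, HolderWith L α (w i))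
    (hα : α < 1) (e : ι → ℤ) (d : κ → ℤ) :
    IsSchurMultiplier H (fun j i => (w i (d j) - w i (e i)) / ((d j - e i : ℤ) : ℂ))
      (24 * (1 - α : ℝ)⁻¹ * L) := by
  have hconj : ∀ i, HolderWith L α (conj ∘ w i) := fun i => by
    simpa using Complex.isometry_conj.lipschitz.holderWith.comp (hw i)
  have h := (isSchurMultiplier_divDiff (H := H) hconj hα e d).conjTranspose
  simpa only [Function.comp_apply, map_div₀, map_sub, RCLike.conj_conj, map_intCast, map_neg,
    ← neg_sub (w _ (d _)), ← neg_sub (d _), Int.cast_neg, neg_div_neg_eq] using h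

theorem norm_sum_sub_mul_inner_le [CompleteSpace H] {f : ℤ × ℤ → ℂ} (hα : α < 1)
    (hf₁ : ∀ b, HolderWith L α fun a => f (a, b)) (hf₂ : ∀ a, HolderWith L α fun b => f (a, b))
    (S T : Finset (ℤ × ℤ)) {p q : ℤ × ℤ → H} (hp : Pairwise fun k l => ⟪p k, p l⟫_ℂ = 0)
    (hq : Pairwise fun k l => ⟪q k, q l⟫_ℂ = 0) {K₁ K₂ : H →L[ℂ] H} {C : ℝ} (hK₁ : ‖K₁‖ ≤ C)
    (hK₂ : ‖K₂‖ ≤ C) (h₁ : ∀ k l, ⟪p k, K₁ (q l)⟫_ℂ = (k.1 - l.1 : ℤ) * ⟪p k, q l⟫_ℂ)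
    (h₂ : ∀ k l, ⟪p k, K₂ (q l)⟫_ℂ = (k.2 - l.2 : ℤ) * ⟪p k, q l⟫_ℂ) :
    ‖∑ k ∈ S, ∑ l ∈ T, (f k - f l) * ⟪p k, q l⟫_ℂ‖ ≤
      48 * (1 - α : ℝ)⁻¹ * L * C * √(∑ k ∈ S, ‖p k‖ ^ 2) * √(∑ l ∈ T, ‖q l‖ ^ 2) := by
  have hα' : (0 : ℝ) < 1 - α := sub_pos.2 (by exact_mod_cast hα)
  have hcancel (u : ℤ → ℂ) (a b : ℤ) : (u a - u b) / ((a - b : ℤ) : ℂ) * ((a - b : ℤ) : ℂ) =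
      u a - u b := div_mul_cancel_of_imp fun h => by
    rw [sub_eq_zero.1 (Int.cast_eq_zero.1 h), sub_self]
  have hsplit (k l : ℤ × ℤ) : (f k - f l) * ⟪p k, q l⟫_ℂ =
      (f (k.1, k.2) - f (l.1, k.2)) / ((k.1 - l.1 : ℤ) : ℂ) * ⟪p k, K₁ (q l)⟫_ℂ +
      (f (l.1, k.2) - f (l.1, l.2)) / ((k.2 - l.2 : ℤ) : ℂ) * ⟪p k, K₂ (q l)⟫_ℂ := by
    rw [h₁, h₂, ← mul_assoc, ← mul_assoc, hcancel fun a => f (a, k.2), hcancel fun b => f (l.1, b)]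
    ring
  simp only [hsplit, Finset.sum_add_distrib]
  refine (norm_add_le_of_le
    (isSchurMultiplier_divDiff (fun k : ℤ × ℤ => hf₁ k.2) hα Prod.fst Prod.fst S T p q hp hq K₁)
    (isSchurMultiplier_divDiff_right (fun l : ℤ × ℤ => hf₂ l.1) hα Prod.snd Prod.snd
      S T p q hp hq K₂)).trans ?_
  rw [← mul_add]
  calc _ ≤ 24 * (1 - α : ℝ)⁻¹ * L * (C * √(∑ k ∈ S, ‖p k‖ ^ 2) * √(∑ l ∈ T, ‖q l‖ ^ 2) +
        C * √(∑ k ∈ S, ‖p k‖ ^ 2) * √(∑ l ∈ T, ‖q l‖ ^ 2)) := by gcongr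
    _ = _ := by ring

end HolderDivDiff

/-! ### Integrals against a spectral measure -/

section OpNormSub

variable {H : Type*} [NormedAddCommGroup H] [InnerProductSpace ℂ H] {A B C : H →ₗ.[ℂ] H}
  {a b c : ℝ}

theorem opNormSub_le_ofReal_iff (hc : 0 ≤ c) : opNormSub A B ≤ ENNReal.ofReal c ↔
    A.domain = B.domain ∧ ∀ x y z, (x, y) ∈ A.graph → (x, z) ∈ B.graph → ‖y - z‖ ≤ c * ‖x‖ := by
  have hdiv : ∀ x y : H, ‖y‖ₑ / ‖x‖ₑ ≤ ENNReal.ofReal c ∧ (x = 0 → y = 0) ↔ ‖y‖ ≤ c * ‖x‖ := by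
    intro x y
    rcases eq_or_ne x 0 with rfl | hx
    · rw [norm_zero, mul_zero, norm_le_zero_iff]
      exact ⟨fun h => h.2 rfl, fun h => ⟨by simp [h], fun _ => h⟩⟩
    · rw [ENNReal.div_le_iff (by simpa) (by simp), ← ofReal_norm, ← ofReal_norm,
        ← ENNReal.ofReal_mul hc, ENNReal.ofReal_le_ofReal_iff (by positivity)]
      exact and_iff_left fun h => absurd h hx
  have hsub : ∀ x : (A - B).domain, (x : H) = 0 → (A - B) x = 0 := fun x hx => by
    rw [Subtype.ext (a1 := x) (a2 := 0) hx, LinearPMap.map_zero]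
  rw [opNormSub]
  split_ifs with h
  · simp only [iSup_le_iff, h, true_and]
    refine ⟨fun hb x y z hy hz => ?_, fun hb x => ?_⟩
    · obtain ⟨⟨x, hxA⟩, rfl, rfl⟩ := LinearPMap.mem_graph_iff A |>.1 hy
      obtain ⟨⟨x, hxB⟩, rfl, rfl⟩ := LinearPMap.mem_graph_iff B |>.1 hz
      exact (hdiv _ _).1 ⟨hb ⟨_, hxA, hxB⟩, hsub ⟨_, hxA, hxB⟩⟩
    · exact ((hdiv _ _).2 (hb x _ _ (A.mem_graph ⟨x, x.2.1⟩) (B.mem_graph ⟨x, x.2.2⟩))).1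
  · simp [h]

theorem opNormSub_comm (A B : H →ₗ.[ℂ] H) : opNormSub A B = opNormSub B A := by
  have hle : ∀ A B : H →ₗ.[ℂ] H, opNormSub A B ≤ opNormSub B A := fun A B => by
    rcases eq_or_ne (opNormSub B A) ∞ with h | h
    · simp [h]
    obtain ⟨hdom, hBA⟩ := (opNormSub_le_ofReal_iff ENNReal.toReal_nonneg).1
      (ENNReal.ofReal_toReal h).ge
    rw [← ENNReal.ofReal_toReal h, opNormSub_le_ofReal_iff ENNReal.toReal_nonneg]
    exact ⟨hdom.symm, fun x y z hy hz => norm_sub_rev y z ▸ hBA x z y hz hy⟩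
  exact (hle A B).antisymm (hle B A)

theorem opNormSub_triangle (A B C : H →ₗ.[ℂ] H) :
    opNormSub A C ≤ opNormSub A B + opNormSub B C := by
  rcases eq_or_ne (opNormSub A B) ∞ with hAB | hAB
  · simp [hAB]
  rcases eq_or_ne (opNormSub B C) ∞ with hBC | hBC
  · simp [hBC]
  obtain ⟨hdom, hab⟩ := (opNormSub_le_ofReal_iff ENNReal.toReal_nonneg).1
    (ENNReal.ofReal_toReal hAB).ge
  obtain ⟨hdom', hbc⟩ := (opNormSub_le_ofReal_iff ENNReal.toReal_nonneg).1
    (ENNReal.ofReal_toReal hBC).ge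
  rw [← ENNReal.ofReal_toReal hAB, ← ENNReal.ofReal_toReal hBC,
    ← ENNReal.ofReal_add ENNReal.toReal_nonneg ENNReal.toReal_nonneg,
    opNormSub_le_ofReal_iff (by positivity)]
  refine ⟨hdom.trans hdom', fun x y w hy hw => ?_⟩
  obtain ⟨z, hz⟩ := LinearPMap.mem_domain_iff.1 (hdom' ▸ LinearPMap.mem_domain_of_mem_graph hw)
  calc ‖y - w‖ ≤ ‖y - z‖ + ‖z - w‖ := norm_sub_le_norm_sub_add_norm_sub y z w
    _ ≤ _ := by linarith [hab x y z hy hz, hbc x z w hz hw]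

theorem exists_clm_apply_eq_sub [CompleteSpace H] (hA : Dense (A.domain : Set H)) (hc : 0 ≤ c)
    (h : opNormSub A B ≤ ENNReal.ofReal c) : ∃ K : H →L[ℂ] H, ‖K‖ ≤ c ∧
      ∀ x y z, (x, y) ∈ A.graph → (x, z) ∈ B.graph → K x = y - z := by
  obtain ⟨hdom, hAB⟩ := (opNormSub_le_ofReal_iff hc).1 h
  let D : A.domain →ₗ[ℂ] H := A.toFun - B.toFun.comp (Submodule.inclusion hdom.le)
  have hD : ∀ x, ‖D x‖ ≤ c * ‖A.domain.subtype x‖ := fun x =>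
    hAB x _ _ (A.mem_graph x) (B.mem_graph ⟨x, hdom ▸ x.2⟩)
  have hrange : DenseRange A.domain.subtype := by simpa [DenseRange] using hA
  refine ⟨D.extendOfNorm A.domain.subtype, LinearMap.opNorm_extendOfNorm_le hrange hc hD,
    fun x y z hy hz => ?_⟩
  obtain ⟨x, rfl, rfl⟩ := (LinearPMap.mem_graph_iff A).1 hy
  obtain ⟨x', hx, rfl⟩ := (LinearPMap.mem_graph_iff B).1 hz
  obtain rfl : x' = Submodule.inclusion hdom.le x := Subtype.ext hx
  exact LinearMap.extendOfNorm_eq hrange ⟨c, hD⟩ x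

end OpNormSub

namespace SpectralMeasure

variable {H : Type*} [NormedAddCommGroup H] [InnerProductSpace ℂ H] [CompleteSpace H]
variable (E : SpectralMeasure H) {f g : ℂ → ℂ} {S : Set ℂ}

theorem inner_proj_left (hS : MeasurableSet S) (x y : H) :
    ⟪E.proj S x, y⟫_ℂ = ⟪x, E.proj S y⟫_ℂ :=
  (E.isStarProjection S hS).isSelfAdjoint.isSymmetric x y

theorem proj_comm {T : Set ℂ} (hS : MeasurableSet S) (hT : MeasurableSet T) (x : H) :
    E.proj S (E.proj T x) = E.proj T (E.proj S x) := by
  rw [← mul_apply_eq_comp, ← mul_apply_eq_comp, ← E.proj_inter S T hS hT,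
    ← E.proj_inter T S hT hS, Set.inter_comm]

theorem scalarMeasure_univ (x : H) : E.scalarMeasure x Set.univ = ‖x‖ₑ ^ 2 := by
  rw [E.scalarMeasure_apply x MeasurableSet.univ, E.proj_univ, one_apply_eq_self]

theorem scalarMeasure_proj (hS : MeasurableSet S) (x : H) :
    E.scalarMeasure (E.proj S x) = (E.scalarMeasure x).restrict S := by
  refine Measure.ext fun T hT => ?_
  rw [Measure.restrict_apply hT, E.scalarMeasure_apply _ hT,
    E.scalarMeasure_apply _ (hT.inter hS), E.proj_inter T S hT hS, mul_apply_eq_comp]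

theorem simpleIntegral_proj (s : SimpleFunc ℂ ℂ) (hS : MeasurableSet S) (x : H) :
    E.simpleIntegral s (E.proj S x) = E.proj S (E.simpleIntegral s x) := by
  simp only [simpleIntegral, sum_apply, smul_apply, map_sum, map_smul,
    fun c => E.proj_comm (s.measurableSet_fiber c) hS]

theorem simpleIntegral_const (c : ℂ) (x : H) :
    E.simpleIntegral (SimpleFunc.const ℂ c) x = c • x := by
  have h : ⇑(SimpleFunc.const ℂ c) ⁻¹' {c} = Set.univ := by ext z; simp
  rw [simpleIntegral, SimpleFunc.range_const, Finset.sum_singleton, h, E.proj_univ]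
  simp

theorem mem_integral_domain {hf : Measurable f} {x : H} :
    x ∈ (E.integral f hf).domain ↔ MemLp f 2 (E.scalarMeasure x) := Iff.rfl

theorem tendsto_approx_integral (hf : Measurable f) (x : (E.integral f hf).domain) :
    Tendsto (fun n => E.simpleIntegral (approx f hf n) x) atTop (𝓝 (E.integral f hf x)) :=
  (E.exists_tendsto_simpleIntegral hf x.2).choose_spec

theorem tendsto_eLpNorm_approx (hf : Measurable f) {x : H}
    (hx : MemLp f 2 (E.scalarMeasure x)) :
    Tendsto (fun n => eLpNorm (⇑(approx f hf n) - f) 2 (E.scalarMeasure x)) atTop (𝓝 0) :=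
  SimpleFunc.tendsto_approxOn_Lp_eLpNorm hf _ (by simp) (by simp) (by simpa using hx.2)

theorem enorm_simpleIntegral_sub_integral_le (s : SimpleFunc ℂ ℂ) (hf : Measurable f)
    (x : (E.integral f hf).domain) : ‖E.simpleIntegral s x - E.integral f hf x‖ₑ ≤
      eLpNorm (⇑s - f) 2 (E.scalarMeasure x) := by
  refine le_of_tendsto_of_tendsto' ((E.tendsto_approx_integral hf x).const_sub _).enorm
    (by simpa using (E.tendsto_eLpNorm_approx hf x.2).const_add _) fun n => ?_
  rw [← E.simpleIntegral_sub, E.enorm_simpleIntegral, SimpleFunc.coe_sub,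
    ← sub_sub_sub_cancel_right _ _ f]
  exact eLpNorm_sub_le (s.measurable.sub hf).aestronglyMeasurable
    ((approx f hf n).measurable.sub hf).aestronglyMeasurable (by norm_num)

theorem enorm_integral_sub_le (hf : Measurable f) (hg : Measurable g) {x : H}
    (hxf : x ∈ (E.integral f hf).domain) (hxg : x ∈ (E.integral g hg).domain) :
    ‖E.integral f hf ⟨x, hxf⟩ - E.integral g hg ⟨x, hxg⟩‖ₑ ≤
      eLpNorm (f - g) 2 (E.scalarMeasure x) := by
  refine le_of_tendsto_of_tendsto' ((E.tendsto_approx_integral hf ⟨x, hxf⟩).sub_const _).enorm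
    (by simpa using (E.tendsto_eLpNorm_approx hf hxf).add_const _) fun n => ?_
  refine (E.enorm_simpleIntegral_sub_integral_le _ hg ⟨x, hxg⟩).trans ?_
  rw [← sub_add_sub_cancel _ f g]
  exact eLpNorm_add_le ((approx f hf n).measurable.sub hf).aestronglyMeasurable
    (hf.sub hg).aestronglyMeasurable (by norm_num)

theorem opNormSub_integral_le (hf : Measurable f) (hg : Measurable g) {c : ℝ}
    (hfg : ∀ z, ‖f z - g z‖ ≤ c) :
    opNormSub (E.integral f hf) (E.integral g hg) ≤ ENNReal.ofReal c := by
  have hc : 0 ≤ c := (norm_nonneg _).trans (hfg 0)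
  have hmem : ∀ x, MemLp (f - g) 2 (E.scalarMeasure x) := fun x =>
    MemLp.of_bound (hf.sub hg).aestronglyMeasurable c (ae_of_all _ hfg)
  have hdom : ∀ x, x ∈ (E.integral f hf).domain ↔ x ∈ (E.integral g hg).domain := fun x =>
    ⟨fun h => by simpa [mem_integral_domain] using MemLp.sub h (hmem x),
      fun h => by simpa [mem_integral_domain] using MemLp.add (hmem x) h⟩
  refine (opNormSub_le_ofReal_iff hc).2 ⟨Submodule.ext hdom, fun x y z hy hz => ?_⟩
  obtain ⟨⟨x, hxf⟩, rfl, rfl⟩ := (LinearPMap.mem_graph_iff _).1 hy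
  obtain ⟨⟨x, hxg⟩, rfl, rfl⟩ := (LinearPMap.mem_graph_iff _).1 hz
  have h := (E.enorm_integral_sub_le hf hg hxf hxg).trans
    (eLpNorm_le_of_ae_bound (p := 2) (ae_of_all _ hfg))
  have hroot : (‖x‖ₑ ^ 2) ^ (2 : ℝ≥0∞).toReal⁻¹ = ‖x‖ₑ := by
    simpa using ENNReal.pow_rpow_inv_natCast two_ne_zero ‖x‖ₑ
  rwa [E.scalarMeasure_univ, hroot, ← ofReal_norm, ← ofReal_norm,
    ← ENNReal.ofReal_mul (norm_nonneg _), ENNReal.ofReal_le_ofReal_iff (by positivity),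
    mul_comm] at h

theorem proj_integral_of_eqOn (hf : Measurable f) (hS : MeasurableSet S) {c : ℂ}
    (hc : ∀ z ∈ S, f z = c) (x : (E.integral f hf).domain) :
    E.proj S (E.integral f hf x) = c • E.proj S x := by
  have hx : E.proj S x ∈ (E.integral f hf).domain := by
    rw [mem_integral_domain, E.scalarMeasure_proj hS]
    exact MemLp.restrict S x.2
  have hcomm : E.integral f hf ⟨_, hx⟩ = E.proj S (E.integral f hf x) := by
    refine tendsto_nhds_unique (E.tendsto_approx_integral hf _) ?_
    simpa only [Function.comp_def, ← E.simpleIntegral_proj _ hS] using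
      ((E.proj S).continuous.tendsto _).comp (E.tendsto_approx_integral hf x)
  have hzero : eLpNorm (⇑(SimpleFunc.const ℂ c) - f) 2 (E.scalarMeasure (E.proj S x)) = 0 := by
    rw [E.scalarMeasure_proj hS, eLpNorm_congr_ae (g := 0), eLpNorm_zero]
    filter_upwards [ae_restrict_mem hS] with z hz
    simp [hc z hz]
  have hle := E.enorm_simpleIntegral_sub_integral_le (SimpleFunc.const ℂ c) hf ⟨_, hx⟩
  rw [hzero, nonpos_iff_eq_zero, enorm_eq_zero, sub_eq_zero, E.simpleIntegral_const] at hle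
  rw [← hcomm, ← hle]

end SpectralMeasure

namespace SpectralMeasure

variable {H : Type*} [NormedAddCommGroup H] [InnerProductSpace ℂ H] [CompleteSpace H]
  {ι : Type*} [MeasurableSpace ι] [MeasurableSingletonClass ι]
  {β : ℂ → ι} (hβ : Measurable β)

section Step

variable (E : SpectralMeasure H) {g : ι → ℂ} {x y : H}

include hβ

theorem pairwise_inner_proj_fiber (x : ι → H) :
    Pairwise fun k l => ⟪E.proj (β ⁻¹' {k}) (x k), E.proj (β ⁻¹' {l}) (x l)⟫_ℂ = 0 :=
  fun k l h => E.inner_proj_of_disjoint (hβ (measurableSet_singleton k))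
    (hβ (measurableSet_singleton l)) (Disjoint.preimage _ (Set.disjoint_singleton.2 h)) _ _

theorem proj_fiber_proj_fiber [DecidableEq ι] (k l : ι) (x : H) :
    E.proj (β ⁻¹' {k}) (E.proj (β ⁻¹' {l}) x) = if k = l then E.proj (β ⁻¹' {k}) x else 0 := by
  rw [← mul_apply_eq_comp, ← E.proj_inter _ _ (hβ (measurableSet_singleton k))
    (hβ (measurableSet_singleton l)), ← Set.preimage_inter]
  split_ifs with h
  · rw [h, Set.inter_self]
  · rw [Set.singleton_inter_eq_empty.2 (by simpa using h), Set.preimage_empty, E.proj_empty,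
      zero_apply]

variable [Countable ι]

theorem hasSum_proj_fiber (x : H) : HasSum (fun k => E.proj (β ⁻¹' {k}) x) x := by
  obtain ⟨e, he⟩ := exists_injective_nat ι
  have hsum := E.hasSum_proj (fun n => e ∘ β ⁻¹' {n})
    (fun n => (measurable_of_countable e).comp hβ (measurableSet_singleton n))
    (fun _ _ h => Disjoint.preimage _ (Set.disjoint_singleton.2 h)) x
  rw [← Set.preimage_iUnion, Set.iUnion_of_singleton, Set.preimage_univ, E.proj_univ,
    one_apply_eq_self, ← he.hasSum_iff fun n hn => ?_] at hsum
  · simpa only [Function.comp_def, Set.preimage_ofPred_eq, Set.preimage, Set.mem_singleton_iff,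
      he.eq_iff] using hsum
  · have hempty : e ∘ β ⁻¹' {n} = ∅ :=
      Set.eq_empty_of_forall_notMem fun z hz => hn ⟨β z, hz⟩
    rw [hempty, E.proj_empty, zero_apply]

theorem hasSum_norm_proj_fiber_sq (x : H) :
    HasSum (fun k => ‖E.proj (β ⁻¹' {k}) x‖ ^ 2) (‖x‖ ^ 2) := by
  have h := ((E.hasSum_proj_fiber hβ x).mapL (innerSL ℂ x)).mapL RCLike.reCLM
  simpa only [innerSL_apply_apply, RCLike.reCLM_apply, inner_self_eq_norm_sq,
    ← E.norm_proj_sq (hβ (measurableSet_singleton _))] using h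

theorem eq_of_proj_fiber_eq (h : ∀ k, E.proj (β ⁻¹' {k}) x = E.proj (β ⁻¹' {k}) y) : x = y := by
  have hx := E.hasSum_proj_fiber hβ x
  simp only [h] at hx
  exact hx.unique (E.hasSum_proj_fiber hβ y)

theorem lintegral_comp_scalarMeasure (F : ι → ℝ≥0∞) (x : H) :
    ∫⁻ z, F (β z) ∂E.scalarMeasure x = ∑' k, F k * ‖E.proj (β ⁻¹' {k}) x‖ₑ ^ 2 := by
  rw [← lintegral_map (measurable_of_countable F) hβ, lintegral_countable']
  simp only [Measure.map_apply hβ (measurableSet_singleton _),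
    E.scalarMeasure_apply x (hβ (measurableSet_singleton _))]

/-- The operator `∑ k, g k • E(β = k)`, i.e. the integral of the function `g ∘ β`, which is
constant on the fibers of `β`. -/
def stepIntegral (g : ι → ℂ) : H →ₗ.[ℂ] H :=
  E.integral (g ∘ β) ((measurable_of_countable g).comp hβ)

theorem mem_stepIntegral_domain (h : Summable fun k => ‖g k • E.proj (β ⁻¹' {k}) x‖ ^ 2) :
    x ∈ (E.stepIntegral hβ g).domain := by
  refine E.mem_integral_domain.2
    ⟨((measurable_of_countable g).comp hβ).aestronglyMeasurable, ?_⟩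
  rw [eLpNorm_lt_top_iff_lintegral_rpow_enorm_lt_top (by simp) (by simp)]
  simp only [ENNReal.toReal_ofNat, ENNReal.rpow_ofNat, Function.comp_apply]
  rw [E.lintegral_comp_scalarMeasure hβ (fun k => ‖g k‖ₑ ^ 2)]
  simpa only [ENNReal.ofReal_pow (norm_nonneg _), ofReal_norm, enorm_smul, mul_pow] using
    h.tsum_ofReal_lt_top

theorem mem_graph_stepIntegral_iff : (x, y) ∈ (E.stepIntegral hβ g).graph ↔
    ∀ k, E.proj (β ⁻¹' {k}) y = g k • E.proj (β ⁻¹' {k}) x := by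
  have hproj : ∀ x k, E.proj (β ⁻¹' {k}) (E.stepIntegral hβ g x) = g k • E.proj (β ⁻¹' {k}) x :=
    fun x k => E.proj_integral_of_eqOn _ (hβ (measurableSet_singleton k))
      (fun z hz => congrArg g hz) x
  rw [LinearPMap.mem_graph_iff]
  constructor
  · rintro ⟨x, rfl, rfl⟩ k
    exact hproj x k
  · intro h
    have hx : x ∈ (E.stepIntegral hβ g).domain := E.mem_stepIntegral_domain hβ <| by
      simpa only [h] using (E.hasSum_norm_proj_fiber_sq hβ y).summable
    exact ⟨⟨x, hx⟩, rfl, E.eq_of_proj_fiber_eq hβ fun k => by rw [hproj, h]⟩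

theorem proj_fiber_mem_graph_stepIntegral (g : ι → ℂ) (k : ι) (x : H) :
    (E.proj (β ⁻¹' {k}) x, g k • E.proj (β ⁻¹' {k}) x) ∈ (E.stepIntegral hβ g).graph := by
  classical
  refine (E.mem_graph_stepIntegral_iff hβ).2 fun l => ?_
  rw [map_smul, E.proj_fiber_proj_fiber hβ]
  split_ifs with h
  · rw [h]
  · rw [smul_zero, smul_zero]

theorem dense_stepIntegral_domain (g : ι → ℂ) : Dense ((E.stepIntegral hβ g).domain : Set H) :=
  fun x => mem_closure_of_tendsto (E.hasSum_proj_fiber hβ x) <| Eventually.of_forall fun _ =>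
    Submodule.sum_mem _ fun k _ =>
      LinearPMap.mem_domain_of_mem_graph (E.proj_fiber_mem_graph_stepIntegral hβ g k x)

end Step

variable [Countable ι] {E₁ E₂ : SpectralMeasure H} {g : ι → ℂ}

theorem inner_proj_fiber_apply {K : H →L[ℂ] H}
    (hdom : (E₁.stepIntegral hβ g).domain = (E₂.stepIntegral hβ g).domain)
    (hK : ∀ x y z, (x, y) ∈ (E₁.stepIntegral hβ g).graph →
      (x, z) ∈ (E₂.stepIntegral hβ g).graph → K x = y - z) (k l : ι) (x y : H) :
    ⟪E₁.proj (β ⁻¹' {k}) x, K (E₂.proj (β ⁻¹' {l}) y)⟫_ℂ =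
      (g k - g l) * ⟪E₁.proj (β ⁻¹' {k}) x, E₂.proj (β ⁻¹' {l}) y⟫_ℂ := by
  have hz := E₂.proj_fiber_mem_graph_stepIntegral hβ g l y
  obtain ⟨w, hw⟩ := LinearPMap.mem_domain_iff.1 (hdom ▸ LinearPMap.mem_domain_of_mem_graph hz)
  have hk : MeasurableSet (β ⁻¹' {k}) := hβ (measurableSet_singleton k)
  rw [hK _ _ _ hw hz, inner_sub_right, inner_smul_right, E₁.inner_proj_left hk x w,
    (E₁.mem_graph_stepIntegral_iff hβ).1 hw k, inner_smul_right, ← E₁.inner_proj_left hk]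
  ring

theorem inner_proj_fiber_adjoint_apply {K : H →L[ℂ] H}
    (hdom : (E₁.stepIntegral hβ g).domain = (E₂.stepIntegral hβ g).domain)
    (hK : ∀ x y z, (x, y) ∈ (E₁.stepIntegral hβ g).graph →
      (x, z) ∈ (E₂.stepIntegral hβ g).graph → K x = y - z) (k l : ι) (x y : H) :
    ⟪E₁.proj (β ⁻¹' {k}) x, K.adjoint (E₂.proj (β ⁻¹' {l}) y)⟫_ℂ =
      starRingEnd ℂ (g k - g l) * ⟪E₁.proj (β ⁻¹' {k}) x, E₂.proj (β ⁻¹' {l}) y⟫_ℂ := by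
  have hneg := inner_proj_fiber_apply hβ (K := -K) hdom.symm
    (fun x y z hy hz => by rw [neg_apply, hK x z y hz hy, neg_sub]) l k y x
  rw [neg_apply, inner_neg_right, neg_eq_iff_eq_neg, ← neg_mul, neg_sub] at hneg
  rw [ContinuousLinearMap.adjoint_inner_right, ← inner_conj_symm, hneg, map_mul, inner_conj_symm]

section FormBound

variable {C : ℝ} (hC : ∀ (S T : Finset ι) (x y : H), ‖∑ k ∈ S, ∑ l ∈ T,
    (g k - g l) * ⟪E₁.proj (β ⁻¹' {k}) x, E₂.proj (β ⁻¹' {l}) y⟫_ℂ‖ ≤ C * ‖x‖ * ‖y‖)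

include hC

theorem norm_sum_inner_proj_fiber_le {y z : H} (hz : (y, z) ∈ (E₂.stepIntegral hβ g).graph)
    (S : Finset ι) (x : H) :
    ‖∑ k ∈ S, ⟪E₁.proj (β ⁻¹' {k}) x, g k • y - z⟫_ℂ‖ ≤ C * ‖x‖ * ‖y‖ := by
  have hsum : ∀ k, HasSum
      (fun l => (g k - g l) * ⟪E₁.proj (β ⁻¹' {k}) x, E₂.proj (β ⁻¹' {l}) y⟫_ℂ)
      ⟪E₁.proj (β ⁻¹' {k}) x, g k • y - z⟫_ℂ := fun k => by
    have h := (((E₂.hasSum_proj_fiber hβ y).const_smul (g k)).sub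
      (E₂.hasSum_proj_fiber hβ z)).mapL (innerSL ℂ (E₁.proj (β ⁻¹' {k}) x))
    simpa only [(E₂.mem_graph_stepIntegral_iff hβ).1 hz, ← sub_smul, innerSL_apply_apply,
      inner_smul_right] using h
  exact le_of_tendsto' (tendsto_finsetSum S fun k _ => hsum k).norm fun T => hC S T x y

theorem sum_norm_proj_fiber_sq_le {y z : H} (hz : (y, z) ∈ (E₂.stepIntegral hβ g).graph)
    (S : Finset ι) :
    ∑ k ∈ S, ‖E₁.proj (β ⁻¹' {k}) (g k • y - z)‖ ^ 2 ≤ (C * ‖y‖) ^ 2 := by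
  set x := ∑ k ∈ S, E₁.proj (β ⁻¹' {k}) (g k • y - z) with hx
  have hinner : ∑ k ∈ S, ⟪E₁.proj (β ⁻¹' {k}) x, g k • y - z⟫_ℂ = ⟪x, x⟫_ℂ := by
    simp only [E₁.inner_proj_left (hβ (measurableSet_singleton _)), ← inner_sum, ← hx]
  have hle := norm_sum_inner_proj_fiber_le hβ hC hz S x
  rw [hinner, inner_self_eq_norm_sq_to_K, norm_pow, RCLike.norm_ofReal, abs_norm] at hle
  rw [← norm_sum_sq (E₁.pairwise_inner_proj_fiber hβ fun k => g k • y - z), ← hx]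
  nlinarith [sq_nonneg (C * ‖y‖ - ‖x‖)]

theorem exists_mem_graph_stepIntegral (hC₀ : 0 ≤ C) {y z : H}
    (hz : (y, z) ∈ (E₂.stepIntegral hβ g).graph) :
    ∃ w, (y, w) ∈ (E₁.stepIntegral hβ g).graph ∧ ‖w - z‖ ≤ C * ‖y‖ := by
  have hsum := sum_norm_proj_fiber_sq_le hβ hC hz
  have hy : y ∈ (E₁.stepIntegral hβ g).domain := by
    refine E₁.mem_stepIntegral_domain hβ (Summable.of_nonneg_of_le (fun _ => sq_nonneg _)
      (fun k => ?_) (((summable_of_sum_le (fun _ => sq_nonneg _) hsum).add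
        (E₁.hasSum_norm_proj_fiber_sq hβ z).summable).mul_left 2))
    calc ‖g k • E₁.proj (β ⁻¹' {k}) y‖ ^ 2
        = ‖E₁.proj (β ⁻¹' {k}) (g k • y - z) + E₁.proj (β ⁻¹' {k}) z‖ ^ 2 := by
          rw [← map_add, sub_add_cancel, map_smul]
      _ ≤ (‖E₁.proj (β ⁻¹' {k}) (g k • y - z)‖ + ‖E₁.proj (β ⁻¹' {k}) z‖) ^ 2 := by
          gcongr
          exact norm_add_le _ _
      _ ≤ _ := add_sq_le
  obtain ⟨w, hw⟩ := LinearPMap.mem_domain_iff.1 hy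
  refine ⟨w, hw, le_of_sq_le_sq ?_ (by positivity)⟩
  have hwz := E₁.hasSum_norm_proj_fiber_sq hβ (w - z)
  simp only [map_sub, (E₁.mem_graph_stepIntegral_iff hβ).1 hw] at hwz
  simp only [map_sub, map_smul] at hsum
  exact hasSum_le_of_sum_le hwz hsum

end FormBound

end SpectralMeasure

/-! ### Discretization -/

section Cells

/-- The index of the half-open square of the mesh of size `δ` that contains `z`. -/
def cellIndex (δ : ℝ≥0) (z : ℂ) : ℤ × ℤ := (⌊z.re / δ⌋, ⌊z.im / δ⌋)

/-- The lower left corner of the square with index `k` of the mesh of size `δ`. -/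
def cellCorner (δ : ℝ≥0) (k : ℤ × ℤ) : ℂ := δ * (k.1 + k.2 * Complex.I)

variable {δ α L : ℝ≥0}

theorem measurable_cellIndex (δ : ℝ≥0) : Measurable (cellIndex δ) :=
  (Int.measurable_floor.comp (Complex.measurable_re.div_const _)).prodMk
    (Int.measurable_floor.comp (Complex.measurable_im.div_const _))

theorem cellCorner_re (δ : ℝ≥0) (k : ℤ × ℤ) : (cellCorner δ k).re = δ * k.1 := by
  simp [cellCorner]

theorem cellCorner_im (δ : ℝ≥0) (k : ℤ × ℤ) : (cellCorner δ k).im = δ * k.2 := by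
  simp [cellCorner]

theorem abs_sub_mul_floor_div_le (hδ : 0 < δ) (t : ℝ) : |t - δ * ⌊t / δ⌋| ≤ δ := by
  have hδ' : (0 : ℝ) < δ := hδ
  have h₁ := (le_div_iff₀ hδ').1 (Int.floor_le (t / δ))
  have h₂ := (div_lt_iff₀ hδ').1 (Int.lt_floor_add_one (t / δ))
  rw [abs_le]
  constructor <;> linarith

theorem norm_sub_cellCorner_le (hδ : 0 < δ) (z : ℂ) :
    ‖z - cellCorner δ (cellIndex δ z)‖ ≤ 2 * δ := by
  refine (Complex.norm_le_abs_re_add_abs_im _).trans ?_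
  rw [two_mul]
  refine add_le_add ?_ ?_
  · rw [Complex.sub_re, cellCorner_re]
    exact abs_sub_mul_floor_div_le hδ z.re
  · rw [Complex.sub_im, cellCorner_im]
    exact abs_sub_mul_floor_div_le hδ z.im

theorem holderWith_comp_cellCorner_left {f : ℂ → ℂ} (hf : HolderWith L α f) (b : ℤ) :
    HolderWith (L * δ ^ (α : ℝ)) α fun a => f (cellCorner δ (a, b)) := by
  have hcorner : LipschitzWith δ fun a : ℤ => cellCorner δ (a, b) :=
    LipschitzWith.of_dist_le_mul fun a a' => by
      simp [cellCorner, dist_eq_norm, ← mul_sub, ← Int.cast_sub, Complex.norm_intCast,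
        Int.norm_eq_abs]
  simpa [Function.comp_def] using hf.comp hcorner.holderWith

theorem holderWith_comp_cellCorner_right {f : ℂ → ℂ} (hf : HolderWith L α f) (a : ℤ) :
    HolderWith (L * δ ^ (α : ℝ)) α fun b => f (cellCorner δ (a, b)) := by
  have hcorner : LipschitzWith δ fun b : ℤ => cellCorner δ (a, b) :=
    LipschitzWith.of_dist_le_mul fun b b' => by
      simp [cellCorner, dist_eq_norm, ← mul_sub, ← sub_mul, ← Int.cast_sub, Complex.norm_intCast,
        Int.norm_eq_abs]
  simpa [Function.comp_def] using hf.comp hcorner.holderWith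

end Cells

section LatticeForm

variable {H : Type*} [NormedAddCommGroup H] [InnerProductSpace ℂ H] [CompleteSpace H]
  {δ α L : ℝ≥0}

theorem norm_sum_sub_mul_inner_le_of_adjoint {f : ℤ × ℤ → ℂ} (hδ : 0 < δ) (hα : α < 1)
    (hf₁ : ∀ b, HolderWith L α fun a => f (a, b)) (hf₂ : ∀ a, HolderWith L α fun b => f (a, b))
    (S T : Finset (ℤ × ℤ)) {p q : ℤ × ℤ → H} (hp : Pairwise fun k l => ⟪p k, p l⟫_ℂ = 0)
    (hq : Pairwise fun k l => ⟪q k, q l⟫_ℂ = 0) {K : H →L[ℂ] H} {C : ℝ} (hK : ‖K‖ ≤ C * δ)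
    (h : ∀ k l, ⟪p k, K (q l)⟫_ℂ = (cellCorner δ k - cellCorner δ l) * ⟪p k, q l⟫_ℂ)
    (h' : ∀ k l, ⟪p k, K.adjoint (q l)⟫_ℂ =
      conj (cellCorner δ k - cellCorner δ l) * ⟪p k, q l⟫_ℂ) :
    ‖∑ k ∈ S, ∑ l ∈ T, (f k - f l) * ⟪p k, q l⟫_ℂ‖ ≤
      48 * (1 - α : ℝ)⁻¹ * L * C * √(∑ k ∈ S, ‖p k‖ ^ 2) * √(∑ l ∈ T, ‖q l‖ ^ 2) := by
  have hδ' : (δ : ℂ) ≠ 0 := by exact_mod_cast hδ.ne'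
  have hK' : ‖K.adjoint‖ ≤ C * δ := by rwa [LinearIsometryEquiv.norm_map]
  have hscale : ∀ {A : H →L[ℂ] H} {c : ℂ}, ‖c‖ = 2 * δ → ‖A‖ ≤ C * δ + C * δ →
      ‖c⁻¹ • A‖ ≤ C := fun {A c} hc hA => by
    rw [norm_smul, norm_inv, hc, inv_mul_le_iff₀ (by positivity)]
    linarith
  refine norm_sum_sub_mul_inner_le hα hf₁ hf₂ S T hp hq
    (K₁ := (2 * δ : ℂ)⁻¹ • (K + K.adjoint)) (K₂ := (2 * δ * Complex.I : ℂ)⁻¹ • (K - K.adjoint))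
    (hscale (by simp) (norm_add_le_of_le hK hK')) (hscale (by simp) (norm_sub_le_of_le hK hK'))
    (fun k l => ?_) fun k l => ?_
  · rw [smul_apply, add_apply, inner_smul_right, inner_add_right, h, h', ← add_mul,
      Complex.add_conj, ← mul_assoc]
    congr 1
    rw [Complex.sub_re, cellCorner_re, cellCorner_re]
    push_cast
    field_simp
  · rw [smul_apply, sub_apply, inner_smul_right, inner_sub_right, h, h', ← sub_mul,
      Complex.sub_conj, ← mul_assoc]
    congr 1
    rw [Complex.sub_im, cellCorner_im, cellCorner_im]
    push_cast
    field_simp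

end LatticeForm

namespace SpectralMeasure

variable {H : Type*} [NormedAddCommGroup H] [InnerProductSpace ℂ H] [CompleteSpace H]
  {E₁ E₂ : SpectralMeasure H} {δ α L : ℝ≥0}

theorem sqrt_sum_norm_proj_fiber_sq_le {ι : Type*} [Countable ι] [MeasurableSpace ι]
    [MeasurableSingletonClass ι] {β : ℂ → ι} (hβ : Measurable β) (E : SpectralMeasure H)
    (S : Finset ι) (x : H) : √(∑ k ∈ S, ‖E.proj (β ⁻¹' {k}) x‖ ^ 2) ≤ ‖x‖ :=
  Real.sqrt_le_iff.2 ⟨norm_nonneg x,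
    sum_le_hasSum S (fun _ _ => sq_nonneg _) (E.hasSum_norm_proj_fiber_sq hβ x)⟩

theorem exists_mem_graph_stepIntegral_cell {f : ℤ × ℤ → ℂ} (hδ : 0 < δ) (hα : α < 1)
    (hf₁ : ∀ b, HolderWith L α fun a => f (a, b)) (hf₂ : ∀ a, HolderWith L α fun b => f (a, b))
    {C : ℝ} (hC : 0 ≤ C) (h : opNormSub (E₁.stepIntegral (measurable_cellIndex δ) (cellCorner δ))
      (E₂.stepIntegral (measurable_cellIndex δ) (cellCorner δ)) ≤ ENNReal.ofReal (C * δ))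
    {y z : H} (hz : (y, z) ∈ (E₂.stepIntegral (measurable_cellIndex δ) f).graph) :
    ∃ w, (y, w) ∈ (E₁.stepIntegral (measurable_cellIndex δ) f).graph ∧
      ‖w - z‖ ≤ 48 * (1 - α : ℝ)⁻¹ * L * C * ‖y‖ := by
  have hα' : (0 : ℝ) < 1 - α := sub_pos.2 (by exact_mod_cast hα)
  have hm := measurable_cellIndex δ
  have hδC : 0 ≤ C * δ := by positivity
  have hdom := ((opNormSub_le_ofReal_iff hδC).1 h).1
  obtain ⟨K, hKC, hK⟩ := exists_clm_apply_eq_sub (E₁.dense_stepIntegral_domain hm _) hδC h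
  refine exists_mem_graph_stepIntegral hm (fun S T x y => ?_) (by positivity) hz
  refine (norm_sum_sub_mul_inner_le_of_adjoint hδ hα hf₁ hf₂ S T
    (E₁.pairwise_inner_proj_fiber hm fun _ => x) (E₂.pairwise_inner_proj_fiber hm fun _ => y) hKC
    (fun k l => inner_proj_fiber_apply hm hdom hK k l x y)
    (fun k l => inner_proj_fiber_adjoint_apply hm hdom hK k l x y)).trans ?_
  gcongr
  · exact sqrt_sum_norm_proj_fiber_sq_le hm E₁ S x
  · exact sqrt_sum_norm_proj_fiber_sq_le hm E₂ T y

theorem opNormSub_stepIntegral_cell_le {f : ℤ × ℤ → ℂ} (hδ : 0 < δ) (hα : α < 1)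
    (hf₁ : ∀ b, HolderWith L α fun a => f (a, b)) (hf₂ : ∀ a, HolderWith L α fun b => f (a, b))
    {C : ℝ} (hC : 0 ≤ C) (h : opNormSub (E₁.stepIntegral (measurable_cellIndex δ) (cellCorner δ))
      (E₂.stepIntegral (measurable_cellIndex δ) (cellCorner δ)) ≤ ENNReal.ofReal (C * δ)) :
    opNormSub (E₁.stepIntegral (measurable_cellIndex δ) f)
      (E₂.stepIntegral (measurable_cellIndex δ) f) ≤
        ENNReal.ofReal (48 * (1 - α : ℝ)⁻¹ * L * C) := by
  have hα' : (0 : ℝ) < 1 - α := sub_pos.2 (by exact_mod_cast hα)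
  have h' := h
  rw [opNormSub_comm] at h'
  have h₁₂ := fun y z => exists_mem_graph_stepIntegral_cell hδ hα hf₁ hf₂ hC h (y := y) (z := z)
  have h₂₁ := fun y z => exists_mem_graph_stepIntegral_cell hδ hα hf₁ hf₂ hC h' (y := y) (z := z)
  refine (opNormSub_le_ofReal_iff (by positivity)).2
    ⟨Submodule.ext fun y => ?_, fun x y z hy hz => ?_⟩
  · simp only [LinearPMap.mem_domain_iff]
    exact ⟨fun ⟨z, hz⟩ => (h₂₁ y z hz).imp fun _ h => h.1,
      fun ⟨z, hz⟩ => (h₁₂ y z hz).imp fun _ h => h.1⟩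
  · obtain ⟨w, hw, hle⟩ := h₁₂ x z hz
    rwa [LinearPMap.mem_graph_snd_inj _ hy hw rfl]

theorem opNormSub_integral_stepIntegral_le {f : ℂ → ℂ} (hf : Measurable f)
    (hfL : HolderWith L α f) (hδ : 0 < δ) (hα : α ≤ 1) (E : SpectralMeasure H) :
    opNormSub (E.integral f hf) (E.stepIntegral (measurable_cellIndex δ) (f ∘ cellCorner δ)) ≤
      ENNReal.ofReal (2 * (L * δ ^ (α : ℝ))) := by
  refine E.opNormSub_integral_le _ _ fun z => ?_
  have hdist := hfL.dist_le_of_le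
    ((dist_eq_norm z _).trans_le (norm_sub_cellCorner_le hδ z))
  rw [dist_eq_norm] at hdist
  refine hdist.trans ?_
  have htwo : (2 : ℝ) ^ (α : ℝ) ≤ 2 := by
    simpa using Real.rpow_le_rpow_of_exponent_le (x := 2) one_le_two hα
  rw [Real.mul_rpow two_pos.le δ.coe_nonneg, mul_left_comm]
  gcongr

theorem opNormSub_stepIntegral_cellCorner_le (hδ : 0 < δ)
    (h : opNormSub (E₁.integral (fun z => z) measurable_id)
      (E₂.integral (fun z => z) measurable_id) ≤ ENNReal.ofReal δ) :
    opNormSub (E₁.stepIntegral (measurable_cellIndex δ) (cellCorner δ))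
      (E₂.stepIntegral (measurable_cellIndex δ) (cellCorner δ)) ≤ ENNReal.ofReal (5 * δ) := by
  have hround (E : SpectralMeasure H) : opNormSub (E.integral (fun z => z) measurable_id)
      (E.stepIntegral (measurable_cellIndex δ) (cellCorner δ)) ≤ ENNReal.ofReal (2 * δ) :=
    E.opNormSub_integral_le _ _ fun z => norm_sub_cellCorner_le hδ z
  have h₁ := hround E₁
  rw [opNormSub_comm] at h₁
  refine (opNormSub_triangle _ _ _).trans ((add_le_add h₁
    ((opNormSub_triangle _ _ _).trans (add_le_add h (hround E₂)))).trans_eq ?_)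
  rw [← ENNReal.ofReal_add (by positivity) (by positivity),
    ← ENNReal.ofReal_add (by positivity) (by positivity)]
  congr 1
  ring

theorem opNormSub_integral_holder_le {f : ℂ → ℂ} (hf : Measurable f) (hfL : HolderWith L α f)
    (hδ : 0 < δ) (hα : α < 1) (h : opNormSub (E₁.integral (fun z => z) measurable_id)
      (E₂.integral (fun z => z) measurable_id) ≤ ENNReal.ofReal δ) :
    opNormSub (E₁.integral f hf) (E₂.integral f hf) ≤
      ENNReal.ofReal (244 * (1 - α : ℝ)⁻¹ * (L * δ ^ (α : ℝ))) := by
  have hα' : (0 : ℝ) < 1 - α := sub_pos.2 (by exact_mod_cast hα)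
  have hlattice := opNormSub_stepIntegral_cell_le (f := f ∘ cellCorner δ) hδ hα
    (holderWith_comp_cellCorner_left hfL) (holderWith_comp_cellCorner_right hfL) (by norm_num)
    (opNormSub_stepIntegral_cellCorner_le hδ h)
  have hround (E : SpectralMeasure H) := opNormSub_integral_stepIntegral_le hf hfL hδ hα.le E
  have hround₂ := hround E₂
  rw [opNormSub_comm] at hround₂
  refine (opNormSub_triangle _ _ _).trans ((add_le_add (hround E₁)
    ((opNormSub_triangle _ _ _).trans (add_le_add hlattice hround₂))).trans ?_)
  rw [← ENNReal.ofReal_add (by positivity) (by positivity),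
    ← ENNReal.ofReal_add (by positivity) (by positivity)]
  refine ENNReal.ofReal_le_ofReal ?_
  have hone : 1 ≤ (1 - α : ℝ)⁻¹ := (one_le_inv₀ hα').2 (by simp)
  have hLδ : (0 : ℝ) ≤ L * δ ^ (α : ℝ) := by positivity
  rw [NNReal.coe_mul, NNReal.coe_rpow]
  linarith [mul_le_mul_of_nonneg_right hone hLδ]

end SpectralMeasure

/-! ### Borel functional calculus of a representation of `C(X)` -/

namespace BorelCalculus

open CompactlySupported

theorem eLpNorm_two_sq {Y F : Type*} [MeasurableSpace Y] [NormedAddCommGroup F] (g : Y → F)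
    (μ : Measure Y) : eLpNorm g 2 μ ^ 2 = ∫⁻ t, ‖g t‖ₑ ^ 2 ∂μ := by
  have h := eLpNorm_nnreal_pow_eq_lintegral (f := g) (μ := μ) (p := 2) two_ne_zero
  simpa using h

theorem eLpNorm_bounded_mul_le {Y : Type*} [MeasurableSpace Y] {μ : Measure Y} {g h : Y → ℂ}
    {C : ℝ≥0} (hC : ∀ t, ‖g t‖ ≤ C) : eLpNorm (g * h) 2 μ ≤ C * eLpNorm h 2 μ :=
  eLpNorm_le_nnreal_smul_eLpNorm_of_ae_le_mul (ae_of_all _ fun t => by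
    rw [Pi.mul_apply, nnnorm_mul]
    exact mul_le_mul_of_nonneg_right (hC t) (norm_nonneg _)) 2

theorem memLp_bounded_mul {Y : Type*} [MeasurableSpace Y] {μ : Measure Y} {g h : Y → ℂ}
    (hg : Measurable g) {C : ℝ≥0} (hC : ∀ t, ‖g t‖ ≤ C) (hh : MemLp h 2 μ) :
    MemLp (g * h) 2 μ :=
  ⟨hg.aestronglyMeasurable.mul hh.1, (eLpNorm_bounded_mul_le hC).trans_lt
    (ENNReal.mul_lt_top ENNReal.coe_lt_top hh.2)⟩

variable {X : Type*} [TopologicalSpace X]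
  {H : Type*} [NormedAddCommGroup H] [InnerProductSpace ℂ H] [CompleteSpace H]

section VectorMeasure

variable (ρ : C(X, ℂ) →⋆ₐ[ℂ] (H →L[ℂ] H))

theorem inner_map_left (φ : C(X, ℂ)) (x y : H) : ⟪ρ φ x, y⟫_ℂ = ⟪x, ρ (star φ) y⟫_ℂ := by
  rw [map_star, ContinuousLinearMap.star_eq_adjoint, ContinuousLinearMap.adjoint_inner_right]

theorem map_mul_apply (φ ψ : C(X, ℂ)) (x : H) : ρ (φ * ψ) x = ρ φ (ρ ψ x) := by
  rw [map_mul, mul_apply_eq_comp]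

theorem re_inner_map_star_mul_self (φ : C(X, ℂ)) (x : H) :
    (⟪x, ρ (star φ * φ) x⟫_ℂ).re = ‖ρ φ x‖ ^ 2 := by
  rw [map_mul_apply, ← inner_map_left]
  exact inner_self_eq_norm_sq (𝕜 := ℂ) _

variable [T2Space X] [CompactSpace X] [MeasurableSpace X] [BorelSpace X]

/-- The positive functional `f ↦ ⟪x, ρ(f) x⟫`, to which the Riesz–Markov–Kakutani theorem is
applied. -/
def vectorFunctional (x : H) : C_c(X, ℝ) →ₚ[ℝ] ℝ :=
  PositiveLinearMap.mk₀
    { toFun := fun f => (⟪x, ρ (Complex.ofRealCLM.compLeftContinuous ℝ X f) x⟫_ℂ).re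
      map_add' := fun f g => by
        rw [← Complex.add_re, ← inner_add_right, ← add_apply, ← map_add, ← map_add]
        rfl
      map_smul' := fun c f => by
        rw [RingHom.id_apply, smul_eq_mul, ← Complex.re_ofReal_mul, ← inner_smul_right,
          ← smul_apply, ← map_smul, Complex.coe_smul, ← map_smul]
        rfl }
    fun f hf => by
      have hsqrt : Complex.ofRealCLM.compLeftContinuous ℝ X f =
          star (⟨fun t => √(f t), by fun_prop⟩ : C(X, ℂ)) * ⟨fun t => √(f t), by fun_prop⟩ := by
        ext t
        simp [← Complex.ofReal_mul, Real.mul_self_sqrt (hf t)]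
      simp only [LinearMap.coe_mk, AddHom.coe_mk]
      rw [hsqrt, re_inner_map_star_mul_self]
      positivity

/-- The measure `μ` on `X` with `⟪x, ρ(f) x⟫ = ∫ f dμ`. -/
def vectorMeasure (x : H) : Measure X := RealRMK.rieszMeasure (vectorFunctional ρ x)

instance (x : H) : IsFiniteMeasure (vectorMeasure ρ x) := by
  unfold vectorMeasure
  infer_instance

instance (x : H) : (vectorMeasure ρ x).Regular := by
  unfold vectorMeasure
  infer_instance

theorem eLpNorm_vectorMeasure (φ : C(X, ℂ)) (x : H) :
    eLpNorm φ 2 (vectorMeasure ρ x) = ‖ρ φ x‖ₑ := by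
  let f : C_c(X, ℝ) := ⟨⟨fun t => ‖φ t‖ ^ 2, by fun_prop⟩, HasCompactSupport.of_compactSpace _⟩
  have hf : Complex.ofRealCLM.compLeftContinuous ℝ X f = star φ * φ := by
    ext t
    simp [f, Complex.conj_mul']
  have hint : ∫ t, f t ∂vectorMeasure ρ x = ‖ρ φ x‖ ^ 2 := by
    rw [vectorMeasure, RealRMK.integral_rieszMeasure, ← re_inner_map_star_mul_self, ← hf]
    rfl
  have hfi : Integrable f (vectorMeasure ρ x) :=
    f.continuous.integrable_of_hasCompactSupport f.hasCompactSupport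
  have hlint := ofReal_integral_eq_lintegral_ofReal hfi (ae_of_all _ fun t => sq_nonneg ‖φ t‖)
  refine (ENNReal.pow_right_strictMono two_ne_zero).injective ?_
  simp only [eLpNorm_two_sq, ← ofReal_norm, ← ENNReal.ofReal_pow (norm_nonneg _)]
  rw [← hint, hlint]
  rfl

theorem vectorMeasure_univ (x : H) : vectorMeasure ρ x Set.univ = ‖x‖ₑ ^ 2 := by
  have h := eLpNorm_two_sq (1 : C(X, ℂ)) (vectorMeasure ρ x)
  rw [eLpNorm_vectorMeasure, map_one] at h
  simpa using h.symm

/-- The isometry `L²(μ) → H`, `φ ↦ ρ(φ) x`, where `μ` is the measure of `x`. -/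
def vectorIsometry (x : H) : Lp ℂ 2 (vectorMeasure ρ x) →L[ℂ] H :=
  ((ContinuousLinearMap.apply ℂ H x).toLinearMap ∘ₗ ρ.toAlgHom.toLinearMap).extendOfNorm
    (ContinuousMap.toLp (E := ℂ) 2 (vectorMeasure ρ x) ℂ).toLinearMap

theorem norm_toLp_vectorMeasure (φ : C(X, ℂ)) (x : H) :
    ‖ContinuousMap.toLp (E := ℂ) 2 (vectorMeasure ρ x) ℂ φ‖ = ‖ρ φ x‖ := by
  have h := Lp.enorm_toLp (φ.continuous.memLp_of_hasCompactSupport (p := 2)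
    (μ := vectorMeasure ρ x) (HasCompactSupport.of_compactSpace φ))
  rw [eLpNorm_vectorMeasure, enorm_eq_iff_norm_eq] at h
  exact h

theorem vectorIsometry_toLp (φ : C(X, ℂ)) (x : H) :
    vectorIsometry ρ x (ContinuousMap.toLp (E := ℂ) 2 (vectorMeasure ρ x) ℂ φ) = ρ φ x := by
  have hdense : DenseRange (ContinuousMap.toLp (E := ℂ) 2 (vectorMeasure ρ x) ℂ).toLinearMap :=
    ContinuousMap.toLp_denseRange ℂ (vectorMeasure ρ x) ℂ ENNReal.ofNat_ne_top
  unfold vectorIsometry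
  refine LinearMap.extendOfNorm_eq hdense ⟨1, fun ψ => ?_⟩ φ
  rw [one_mul]
  exact (norm_toLp_vectorMeasure ρ ψ x).ge

theorem norm_vectorIsometry (x : H) (g : Lp ℂ 2 (vectorMeasure ρ x)) :
    ‖vectorIsometry ρ x g‖ = ‖g‖ := by
  refine (ContinuousMap.toLp_denseRange (p := 2) ℂ (vectorMeasure ρ x) ℂ
    ENNReal.ofNat_ne_top).induction_on g (isClosed_eq (by fun_prop) (by fun_prop)) fun φ => ?_
  rw [vectorIsometry_toLp, norm_toLp_vectorMeasure]

open Classical in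
/-- The vector `g(ρ) x` for a function `g` that is square integrable with respect to the measure
of `x`; the junk value is `0`. -/
def borelVec (g : X → ℂ) (x : H) : H :=
  if hg : MemLp g 2 (vectorMeasure ρ x) then vectorIsometry ρ x (hg.toLp g) else 0

variable {ρ}

omit [T2Space X] in
theorem memLp_continuousMap (φ : C(X, ℂ)) (μ : Measure X) [IsFiniteMeasure μ] : MemLp φ 2 μ :=
  φ.continuous.memLp_of_hasCompactSupport (HasCompactSupport.of_compactSpace φ)

theorem memLp_vectorMeasure_of_bounded {g : X → ℂ} (hg : Measurable g) {C : ℝ≥0}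
    (hC : ∀ t, ‖g t‖ ≤ C) (x : H) : MemLp g 2 (vectorMeasure ρ x) :=
  MemLp.of_bound hg.aestronglyMeasurable C (ae_of_all _ hC)

theorem enorm_borelVec {g : X → ℂ} {x : H} (hg : MemLp g 2 (vectorMeasure ρ x)) :
    ‖borelVec ρ g x‖ₑ = eLpNorm g 2 (vectorMeasure ρ x) := by
  rw [borelVec, dif_pos hg, ← Lp.enorm_toLp hg, enorm_eq_iff_norm_eq]
  exact norm_vectorIsometry ρ x _

theorem borelVec_coe (φ : C(X, ℂ)) (x : H) : borelVec ρ φ x = ρ φ x := by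
  rw [borelVec, dif_pos (memLp_continuousMap φ _)]
  exact vectorIsometry_toLp ρ φ x

theorem borelVec_zero_fun (x : H) : borelVec ρ (0 : X → ℂ) x = 0 := by
  rw [← ContinuousMap.coe_zero, borelVec_coe, map_zero, zero_apply]

theorem borelVec_one_fun (x : H) : borelVec ρ (1 : X → ℂ) x = x := by
  rw [← ContinuousMap.coe_one, borelVec_coe, map_one, one_apply_eq_self]

theorem borelVec_add_fun {g h : X → ℂ} {x : H} (hg : MemLp g 2 (vectorMeasure ρ x))
    (hh : MemLp h 2 (vectorMeasure ρ x)) :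
    borelVec ρ (g + h) x = borelVec ρ g x + borelVec ρ h x := by
  rw [borelVec, borelVec, borelVec, dif_pos hg, dif_pos hh, dif_pos (hg.add hh), ← map_add,
    MemLp.toLp_add]

theorem borelVec_smul_fun (c : ℂ) {g : X → ℂ} {x : H} (hg : MemLp g 2 (vectorMeasure ρ x)) :
    borelVec ρ (c • g) x = c • borelVec ρ g x := by
  rw [borelVec, borelVec, dif_pos hg, dif_pos (hg.const_smul c), ← map_smul,
    MemLp.toLp_const_smul]

theorem borelVec_sub_fun {g h : X → ℂ} {x : H} (hg : MemLp g 2 (vectorMeasure ρ x))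
    (hh : MemLp h 2 (vectorMeasure ρ x)) :
    borelVec ρ (g - h) x = borelVec ρ g x - borelVec ρ h x := by
  rw [borelVec, borelVec, borelVec, dif_pos hg, dif_pos hh, dif_pos (hg.sub hh), ← map_sub,
    MemLp.toLp_sub]

theorem borelVec_sum_fun {ι : Type*} (s : Finset ι) (g : ι → X → ℂ) {x : H}
    (hg : ∀ i, MemLp (g i) 2 (vectorMeasure ρ x)) :
    borelVec ρ (∑ i ∈ s, g i) x = ∑ i ∈ s, borelVec ρ (g i) x := by
  classical
  induction s using Finset.induction_on with
  | empty => exact borelVec_zero_fun x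
  | insert i s hi ih =>
    rw [Finset.sum_insert hi, Finset.sum_insert hi,
      borelVec_add_fun (hg i) (memLp_finsetSum' s fun i _ => hg i), ih]

theorem tendsto_borelVec {ι : Type*} {l : Filter ι} {g : ι → X → ℂ} {h : X → ℂ} {x : H}
    (hg : ∀ i, MemLp (g i) 2 (vectorMeasure ρ x)) (hh : MemLp h 2 (vectorMeasure ρ x))
    (hgh : Tendsto (fun i => eLpNorm (g i - h) 2 (vectorMeasure ρ x)) l (𝓝 0)) :
    Tendsto (fun i => borelVec ρ (g i) x) l (𝓝 (borelVec ρ h x)) := by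
  rw [tendsto_iff_edist_tendsto_0]
  simpa only [edist_eq_enorm_sub, ← borelVec_sub_fun (hg _) hh, enorm_borelVec ((hg _).sub hh)]
    using hgh

theorem exists_continuousMap_tendsto_eLpNorm_sub {μ : Measure X} [μ.WeaklyRegular] {g : X → ℂ}
    (hg : MemLp g 2 μ) :
    ∃ φ : ℕ → C(X, ℂ), Tendsto (fun n => eLpNorm (⇑(φ n) - g) 2 μ) atTop (𝓝 0) := by
  have hn (n : ℕ) : (n + 1 : ℝ≥0∞)⁻¹ ≠ 0 := ENNReal.inv_ne_zero.2 (by finiteness)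
  choose φ hφ _ using fun n => hg.exists_boundedContinuous_eLpNorm_sub_le
    ENNReal.ofNat_ne_top (hn n)
  refine ⟨fun n => φ n, tendsto_of_tendsto_of_tendsto_of_le_of_le tendsto_const_nhds
    (h := fun n : ℕ => (n + 1 : ℝ≥0∞)⁻¹) ?_ (fun _ => zero_le) fun n => ?_⟩
  · simpa only [Nat.cast_add_one, Function.comp_def] using
      ENNReal.tendsto_inv_nat_nhds_zero.comp (tendsto_add_atTop_nat 1)
  · rw [eLpNorm_sub_comm]
    exact hφ n

theorem tendsto_map_borelVec {g : X → ℂ} {x : H} (hg : MemLp g 2 (vectorMeasure ρ x))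
    {φ : ℕ → C(X, ℂ)}
    (hφ : Tendsto (fun n => eLpNorm (⇑(φ n) - g) 2 (vectorMeasure ρ x)) atTop (𝓝 0)) :
    Tendsto (fun n => ρ (φ n) x) atTop (𝓝 (borelVec ρ g x)) := by
  simpa only [borelVec_coe] using tendsto_borelVec (fun n => memLp_continuousMap (φ n) _) hg hφ

theorem exists_forall_tendsto_borelVec {ι : Type*} [Finite ι] {g : X → ℂ} (hg : Measurable g)
    {C : ℝ≥0} (hC : ∀ t, ‖g t‖ ≤ C) (x : ι → H) :
    ∃ φ : ℕ → C(X, ℂ), ∀ i,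
      Tendsto (fun n => eLpNorm (⇑(φ n) - g) 2 (vectorMeasure ρ (x i))) atTop (𝓝 0) ∧
      Tendsto (fun n => ρ (φ n) (x i)) atTop (𝓝 (borelVec ρ g (x i))) := by
  have := Fintype.ofFinite ι
  obtain ⟨φ, hφ⟩ := exists_continuousMap_tendsto_eLpNorm_sub
    (MemLp.of_bound hg.aestronglyMeasurable C
      (ae_of_all (Measure.sum fun i => vectorMeasure ρ (x i)) hC))
  have hφi (i : ι) : Tendsto (fun n => eLpNorm (⇑(φ n) - g) 2 (vectorMeasure ρ (x i)))
      atTop (𝓝 0) :=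
    tendsto_of_tendsto_of_tendsto_of_le_of_le tendsto_const_nhds hφ (fun _ => zero_le)
      fun n => eLpNorm_mono_measure _ (Measure.le_sum _ i)
  exact ⟨φ, fun i =>
    ⟨hφi i, tendsto_map_borelVec (memLp_vectorMeasure_of_bounded hg hC (x i)) (hφi i)⟩⟩

theorem borelVec_add {g : X → ℂ} (hg : Measurable g) {C : ℝ≥0} (hC : ∀ t, ‖g t‖ ≤ C) (x y : H) :
    borelVec ρ g (x + y) = borelVec ρ g x + borelVec ρ g y := by
  obtain ⟨φ, hφ⟩ := exists_forall_tendsto_borelVec (ρ := ρ) hg hC ![x, y, x + y]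
  exact tendsto_nhds_unique ((hφ 2).2.congr fun n => map_add (ρ (φ n)) x y)
    ((hφ 0).2.add (hφ 1).2)

theorem borelVec_smul {g : X → ℂ} (hg : Measurable g) {C : ℝ≥0} (hC : ∀ t, ‖g t‖ ≤ C) (c : ℂ)
    (x : H) : borelVec ρ g (c • x) = c • borelVec ρ g x := by
  obtain ⟨φ, hφ⟩ := exists_forall_tendsto_borelVec (ρ := ρ) hg hC ![x, c • x]
  exact tendsto_nhds_unique ((hφ 1).2.congr fun n => map_smul (ρ (φ n)) c x)
    ((hφ 0).2.const_smul c)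

theorem norm_borelVec_le {g : X → ℂ} (hg : Measurable g) {C : ℝ≥0} (hC : ∀ t, ‖g t‖ ≤ C) (x : H) :
    ‖borelVec ρ g x‖ ≤ C * ‖x‖ := by
  have hle : eLpNorm g 2 (vectorMeasure ρ x) ≤ C * eLpNorm (1 : X → ℂ) 2 (vectorMeasure ρ x) := by
    simpa only [mul_one] using eLpNorm_bounded_mul_le (h := 1) hC
  rw [← enorm_borelVec (memLp_vectorMeasure_of_bounded hg hC x), ← ContinuousMap.coe_one,
    eLpNorm_vectorMeasure, map_one, one_apply_eq_self, enorm_eq_nnnorm, enorm_eq_nnnorm] at hle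
  exact_mod_cast hle

variable (ρ) in
/-- The operator `g(ρ)` for a bounded Borel function `g`. -/
def borelOp (g : X → ℂ) (hg : Measurable g) {C : ℝ≥0} (hC : ∀ t, ‖g t‖ ≤ C) : H →L[ℂ] H :=
  LinearMap.mkContinuous
    { toFun := borelVec ρ g
      map_add' := borelVec_add hg hC
      map_smul' := borelVec_smul hg hC } C (norm_borelVec_le hg hC)

theorem map_borelVec (ψ : C(X, ℂ)) {g : X → ℂ} {x : H} (hg : MemLp g 2 (vectorMeasure ρ x)) :
    ρ ψ (borelVec ρ g x) = borelVec ρ (ψ * g) x := by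
  obtain ⟨φ, hφ⟩ := exists_continuousMap_tendsto_eLpNorm_sub hg
  have hψ (t : X) : ‖ψ t‖ ≤ ‖ψ‖₊ := ψ.norm_coe_le_norm t
  refine tendsto_nhds_unique (((ρ ψ).continuous.tendsto _).comp
    (tendsto_map_borelVec hg hφ)) ?_
  have h := tendsto_borelVec (fun n => memLp_continuousMap (ψ * φ n) _)
    (memLp_bounded_mul ψ.continuous.measurable hψ hg)
    (tendsto_of_tendsto_of_tendsto_of_le_of_le tendsto_const_nhds
      (h := fun n => ‖ψ‖₊ * eLpNorm (⇑(φ n) - g) 2 (vectorMeasure ρ x))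
      (by simpa using ENNReal.Tendsto.const_mul hφ (Or.inr ENNReal.coe_ne_top))
      (fun _ => zero_le) fun n => by
        rw [ContinuousMap.coe_mul, ← mul_sub]
        exact eLpNorm_bounded_mul_le hψ)
  simpa only [borelVec_coe, map_mul_apply, Function.comp_def] using h

theorem borelVec_map {g : X → ℂ} (hg : Measurable g) {C : ℝ≥0} (hC : ∀ t, ‖g t‖ ≤ C)
    (ψ : C(X, ℂ)) (x : H) : borelVec ρ g (ρ ψ x) = borelVec ρ (g * ψ) x := by
  obtain ⟨φ, hφ⟩ := exists_forall_tendsto_borelVec (ρ := ρ) hg hC ![x, ρ ψ x]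
  rw [mul_comm g, ← map_borelVec ψ (memLp_vectorMeasure_of_bounded hg hC x)]
  refine tendsto_nhds_unique ((hφ 1).2.congr fun n => ?_)
    (((ρ ψ).continuous.tendsto _).comp (hφ 0).2)
  exact (map_mul_apply ρ _ _ x).symm.trans (by rw [mul_comm, map_mul_apply]; rfl)

theorem borelVec_borelVec {g h : X → ℂ} (hg : Measurable g) {C : ℝ≥0} (hC : ∀ t, ‖g t‖ ≤ C)
    {x : H} (hh : MemLp h 2 (vectorMeasure ρ x)) :
    borelVec ρ g (borelVec ρ h x) = borelVec ρ (g * h) x := by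
  obtain ⟨ψ, hψ⟩ := exists_continuousMap_tendsto_eLpNorm_sub hh
  refine tendsto_nhds_unique (((borelOp ρ g hg hC).continuous.tendsto _).comp
    (tendsto_map_borelVec hh hψ)) ?_
  have hlim := tendsto_borelVec
    (fun n => memLp_bounded_mul hg hC (memLp_continuousMap (ψ n) (vectorMeasure ρ x)))
    (memLp_bounded_mul hg hC hh)
    (tendsto_of_tendsto_of_tendsto_of_le_of_le tendsto_const_nhds
      (h := fun n => C * eLpNorm (⇑(ψ n) - h) 2 (vectorMeasure ρ x))
      (by simpa using ENNReal.Tendsto.const_mul hψ (Or.inr ENNReal.coe_ne_top))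
      (fun _ => zero_le) fun n => by
        rw [← mul_sub]
        exact eLpNorm_bounded_mul_le hC)
  exact hlim.congr fun n => (borelVec_map hg hC (ψ n) x).symm

theorem inner_borelVec_left {g : X → ℂ} (hg : Measurable g) {C : ℝ≥0} (hC : ∀ t, ‖g t‖ ≤ C)
    (x y : H) : ⟪borelVec ρ g x, y⟫_ℂ = ⟪x, borelVec ρ (star g) y⟫_ℂ := by
  obtain ⟨φ, hφ⟩ := exists_forall_tendsto_borelVec (ρ := ρ) hg hC ![x, y]
  have hstar : MemLp (star g) 2 (vectorMeasure ρ y) :=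
    (memLp_vectorMeasure_of_bounded hg hC y).star
  have hlim := tendsto_map_borelVec (φ := fun n => star (φ n)) hstar
    ((hφ 1).1.congr fun n => (eLpNorm_star (f := ⇑(φ n) - g)).symm.trans (by
      rw [star_sub, ContinuousMap.coe_star]; rfl))
  refine tendsto_nhds_unique ((hφ 0).2.inner (tendsto_const_nhds (x := y))) ?_
  exact (tendsto_const_nhds.inner hlim).congr fun n => (inner_map_left ρ (φ n) x y).symm

theorem measurable_indicator_one {Y : Type*} [MeasurableSpace Y] {S : Set Y}
    (hS : MeasurableSet S) : Measurable (S.indicator (1 : Y → ℂ)) :=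
  measurable_one.indicator hS

theorem norm_indicator_one_le {Y : Type*} (S : Set Y) (t : Y) :
    ‖S.indicator (1 : Y → ℂ) t‖ ≤ (1 : ℝ≥0) := by
  by_cases h : t ∈ S <;> simp [h]

theorem memLp_indicator_one {S : Set X} (hS : MeasurableSet S) (x : H) :
    MemLp (S.indicator (1 : X → ℂ)) 2 (vectorMeasure ρ x) :=
  memLp_vectorMeasure_of_bounded (measurable_indicator_one hS) (norm_indicator_one_le S) x

theorem enorm_borelVec_indicator_sq {S : Set X} (hS : MeasurableSet S) (x : H) :
    ‖borelVec ρ (S.indicator 1) x‖ₑ ^ 2 = vectorMeasure ρ x S := by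
  have hsq (t : X) : ‖S.indicator (1 : X → ℂ) t‖ₑ ^ 2 = S.indicator 1 t := by
    by_cases h : t ∈ S <;> simp [h]
  simp only [enorm_borelVec (memLp_indicator_one hS x), eLpNorm_two_sq, hsq]
  exact lintegral_indicator_one hS

theorem borelVec_indicator_union {S T : Set X} (hS : MeasurableSet S) (hT : MeasurableSet T)
    (hd : Disjoint S T) (x : H) : borelVec ρ ((S ∪ T).indicator 1) x =
      borelVec ρ (S.indicator 1) x + borelVec ρ (T.indicator 1) x := by
  rw [← borelVec_add_fun (memLp_indicator_one hS x) (memLp_indicator_one hT x),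
    Set.indicator_union_of_disjoint hd]
  rfl

theorem borelVec_indicator_biUnion {ι : Type*} {S : ι → Set X} (hS : ∀ i, MeasurableSet (S i))
    (hd : Pairwise (Function.onFun Disjoint S)) (F : Finset ι) (x : H) :
    borelVec ρ ((⋃ i ∈ F, S i).indicator 1) x = ∑ i ∈ F, borelVec ρ ((S i).indicator 1) x := by
  rw [← borelVec_sum_fun F _ fun i => memLp_indicator_one (hS i) x]
  congr 1
  ext t
  rw [Finset.indicator_biUnion F S (hd.set_pairwise _), Finset.sum_apply]

theorem borelVec_indicator_iUnion_sub_sum {ι : Type*} [Countable ι] {S : ι → Set X}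
    (hS : ∀ i, MeasurableSet (S i)) (hd : Pairwise (Function.onFun Disjoint S)) (F : Finset ι)
    (x : H) :
    borelVec ρ ((⋃ i, S i).indicator 1) x - ∑ i ∈ F, borelVec ρ ((S i).indicator 1) x =
      borelVec ρ ((⋃ i : {i // i ∉ F}, S i).indicator 1) x := by
  have hunion : ⋃ i, S i = (⋃ i ∈ F, S i) ∪ ⋃ i : {i // i ∉ F}, S i := by
    ext t
    simp only [Set.mem_union, Set.mem_iUnion, Subtype.exists, exists_prop]
    grind
  have hdisj : Disjoint (⋃ i ∈ F, S i) (⋃ i : {i // i ∉ F}, S i) := by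
    simp only [Set.disjoint_iUnion_left, Set.disjoint_iUnion_right]
    exact fun j i hi => hd fun hij => j.2 (hij ▸ hi)
  rw [← borelVec_indicator_biUnion hS hd, sub_eq_iff_eq_add', hunion, borelVec_indicator_union
    (F.measurableSet_biUnion fun i _ => hS i)
    (MeasurableSet.iUnion fun i : {i // i ∉ F} => hS i) hdisj]

theorem hasSum_borelVec_indicator {S : ℕ → Set X} (hS : ∀ n, MeasurableSet (S n))
    (hd : Pairwise (Function.onFun Disjoint S)) (x : H) :
    HasSum (fun n => borelVec ρ ((S n).indicator 1) x)
      (borelVec ρ ((⋃ n, S n).indicator 1) x) := by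
  have hsum : ∑' n, vectorMeasure ρ x (S n) ≠ ∞ := by
    rw [← measure_iUnion hd hS]
    exact measure_ne_top _ _
  have hsq : Tendsto (fun F : Finset ℕ => ‖borelVec ρ ((⋃ n, S n).indicator 1) x -
      ∑ n ∈ F, borelVec ρ ((S n).indicator 1) x‖ₑ ^ 2) atTop (𝓝 0) := by
    refine tendsto_of_tendsto_of_tendsto_of_le_of_le tendsto_const_nhds
      (ENNReal.tendsto_tsum_compl_atTop_zero hsum) (fun _ => zero_le) fun F => ?_
    dsimp only
    rw [borelVec_indicator_iUnion_sub_sum hS hd,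
      enorm_borelVec_indicator_sq (MeasurableSet.iUnion fun n : {n // n ∉ F} => hS n)]
    exact measure_iUnion_le _
  have hsqrt := hsq.ennrpow_const (1 / 2)
  simp only [← ENNReal.rpow_natCast, ← ENNReal.rpow_mul] at hsqrt
  rw [HasSum, SummationFilter.unconditional_filter, tendsto_iff_edist_tendsto_0]
  simpa [edist_comm, edist_eq_enorm_sub] using hsqrt

theorem vectorMeasure_map_apply (φ : C(X, ℂ)) (x : H) :
    vectorMeasure ρ (ρ φ x) = (vectorMeasure ρ x).withDensity fun t => ‖φ t‖ₑ ^ 2 := by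
  refine Measure.ext fun S hS => ?_
  have hbound := norm_indicator_one_le S
  rw [← enorm_borelVec_indicator_sq hS, borelVec_map (measurable_indicator_one hS) hbound,
    enorm_borelVec (memLp_bounded_mul (measurable_indicator_one hS) hbound
      (memLp_continuousMap φ _)), eLpNorm_two_sq, withDensity_apply _ hS, ← lintegral_indicator hS]
  refine lintegral_congr fun t => ?_
  by_cases ht : t ∈ S <;> simp [ht]

theorem memLp_div_of_map_eq {b c : C(X, ℂ)} {x v : H} (h : ρ b v = ρ c x) :
    MemLp (⇑c / ⇑b) 2 (vectorMeasure ρ x) := by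
  have hmeas (φ : C(X, ℂ)) : Measurable fun t => ‖φ t‖ₑ ^ 2 := by fun_prop
  have hinv : Measurable fun t => ‖(b t)⁻¹‖ₑ ^ 2 := by fun_prop
  have hle : eLpNorm (⇑c / ⇑b) 2 (vectorMeasure ρ x) ^ 2 ≤ ‖v‖ₑ ^ 2 := calc
    _ = ∫⁻ t, ‖c t‖ₑ ^ 2 * ‖(b t)⁻¹‖ₑ ^ 2 ∂vectorMeasure ρ x := by
      simp only [eLpNorm_two_sq, div_eq_mul_inv, Pi.mul_apply, Pi.inv_apply, enorm_mul, mul_pow]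
    _ = ∫⁻ t, ‖(b t)⁻¹‖ₑ ^ 2 ∂vectorMeasure ρ (ρ c x) := by
      rw [vectorMeasure_map_apply, lintegral_withDensity_eq_lintegral_mul _ (hmeas c) hinv]
      rfl
    _ = ∫⁻ t, ‖b t * (b t)⁻¹‖ₑ ^ 2 ∂vectorMeasure ρ v := by
      rw [← h, vectorMeasure_map_apply, lintegral_withDensity_eq_lintegral_mul _ (hmeas b) hinv]
      simp only [Pi.mul_apply, enorm_mul, mul_pow]
    _ ≤ ∫⁻ _, 1 ∂vectorMeasure ρ v := lintegral_mono fun t => by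
      by_cases hb : b t = 0 <;> simp [hb]
    _ = ‖v‖ₑ ^ 2 := by rw [lintegral_one, vectorMeasure_univ]
  refine ⟨(c.continuous.measurable.div b.continuous.measurable).aestronglyMeasurable, ?_⟩
  exact ((ENNReal.pow_le_pow_left_iff two_ne_zero).1 hle).trans_lt enorm_lt_top

open Classical in
variable (ρ) in
/-- The spectral measure on `ℂ` obtained by pushing the Borel functional calculus of a
representation of `C(X)` forward along a Borel function `π`. -/
def spectralMeasure (π : X → ℂ) (hπ : Measurable π) : SpectralMeasure H where
  proj S := if h : MeasurableSet S then
    borelOp ρ ((π ⁻¹' S).indicator 1) (measurable_indicator_one (hπ h)) (norm_indicator_one_le _)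
    else 0
  isStarProjection S hS := by
    rw [dif_pos hS]
    have hmeas := measurable_indicator_one (hπ hS)
    constructor
    · ext x
      refine (borelVec_borelVec hmeas (norm_indicator_one_le _)
        (memLp_indicator_one (hπ hS) x)).trans ?_
      rw [← Set.inter_indicator_one, Set.inter_self]
      rfl
    · rw [ContinuousLinearMap.isSelfAdjoint_iff_isSymmetric]
      have hstar : star ((π ⁻¹' S).indicator (1 : X → ℂ)) = (π ⁻¹' S).indicator 1 := by
        ext t
        by_cases h : t ∈ π ⁻¹' S <;> simp [h]
      intro x y
      refine (inner_borelVec_left hmeas (norm_indicator_one_le _) x y).trans ?_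
      rw [hstar]
      rfl
  proj_univ := by
    rw [dif_pos MeasurableSet.univ]
    ext x
    simp only [Set.preimage_univ, Set.indicator_univ]
    exact borelVec_one_fun x
  proj_inter S T hS hT := by
    rw [dif_pos hS, dif_pos hT, dif_pos (hS.inter hT)]
    ext x
    simp only [Set.preimage_inter, Set.inter_indicator_one]
    exact (borelVec_borelVec (measurable_indicator_one (hπ hS)) (norm_indicator_one_le _)
      (memLp_indicator_one (hπ hT) x)).symm
  hasSum_proj S hS hd x := by
    simp only [hS, MeasurableSet.iUnion hS, dif_pos, Set.preimage_iUnion]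
    exact hasSum_borelVec_indicator (fun n => hπ (hS n)) (fun i j hij => (hd hij).preimage π) x

variable {π : X → ℂ} (hπ : Measurable π)

theorem spectralMeasure_proj_apply {S : Set ℂ} (hS : MeasurableSet S) (x : H) :
    (spectralMeasure ρ π hπ).proj S x = borelVec ρ ((π ⁻¹' S).indicator 1) x := by
  simp only [spectralMeasure, hS, dif_pos]
  rfl

theorem scalarMeasure_spectralMeasure (x : H) :
    (spectralMeasure ρ π hπ).scalarMeasure x = (vectorMeasure ρ x).map π := by
  refine Measure.ext fun S hS => ?_
  rw [SpectralMeasure.scalarMeasure_apply _ _ hS, spectralMeasure_proj_apply hπ hS,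
    enorm_borelVec_indicator_sq (hπ hS), Measure.map_apply hπ hS]

theorem mem_integral_spectralMeasure_domain {f : ℂ → ℂ} (hf : Measurable f) {x : H} :
    x ∈ ((spectralMeasure ρ π hπ).integral f hf).domain ↔
      MemLp (f ∘ π) 2 (vectorMeasure ρ x) := by
  rw [SpectralMeasure.mem_integral_domain, scalarMeasure_spectralMeasure]
  exact memLp_map_measure_iff hf.aestronglyMeasurable hπ.aemeasurable

theorem simpleIntegral_spectralMeasure (s : SimpleFunc ℂ ℂ) (x : H) :
    (spectralMeasure ρ π hπ).simpleIntegral s x = borelVec ρ (s ∘ π) x := by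
  have hs : ⇑s ∘ π = ∑ c ∈ s.range, c • (π ⁻¹' (s ⁻¹' {c})).indicator (1 : X → ℂ) := by
    ext t
    rw [Finset.sum_apply, Finset.sum_eq_single_of_mem _ (s.mem_range_self (π t))]
    · simp
    · intro c _ hc
      simp [hc.symm]
  have hm (c : ℂ) := memLp_indicator_one (ρ := ρ) (hπ (s.measurableSet_fiber c)) x
  rw [hs, borelVec_sum_fun _ _ fun c => (hm c).const_smul c]
  simp only [SpectralMeasure.simpleIntegral, sum_apply, smul_apply]
  refine Finset.sum_congr rfl fun c _ => ?_
  rw [spectralMeasure_proj_apply hπ (s.measurableSet_fiber c), borelVec_smul_fun c (hm c)]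

theorem integral_spectralMeasure {f : ℂ → ℂ} (hf : Measurable f)
    (x : ((spectralMeasure ρ π hπ).integral f hf).domain) :
    (spectralMeasure ρ π hπ).integral f hf x = borelVec ρ (f ∘ π) x := by
  have hx := (mem_integral_spectralMeasure_domain hπ hf).1 x.2
  have happrox (n : ℕ) :
      MemLp (SpectralMeasure.approx f hf n ∘ π) 2 (vectorMeasure ρ (x : H)) := by
    rw [← memLp_map_measure_iff (SimpleFunc.aestronglyMeasurable _) hπ.aemeasurable]
    exact SimpleFunc.memLp_of_isFiniteMeasure _ _ _
  refine tendsto_nhds_unique ((spectralMeasure ρ π hπ).tendsto_approx_integral hf x) ?_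
  simp only [simpleIntegral_spectralMeasure]
  refine tendsto_borelVec happrox hx
    (((spectralMeasure ρ π hπ).tendsto_eLpNorm_approx hf x.2).congr fun n => ?_)
  rw [scalarMeasure_spectralMeasure, eLpNorm_map_measure
    ((SimpleFunc.measurable _).sub hf).aestronglyMeasurable hπ.aemeasurable]
  rfl

end VectorMeasure

end BorelCalculus

/-! ### The spectral theorem -/

universe u

theorem exists_continuousMap_representation {A : Type u} [CStarAlgebra A] {s : Set A}
    (hs : ∀ a ∈ s, ∀ b ∈ s, a * b = b * a) (hs' : ∀ a ∈ s, ∀ b ∈ s, a * star b = star b * a) :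
    ∃ (X : Type u) (_ : TopologicalSpace X) (_ : T2Space X) (_ : CompactSpace X)
      (ρ : C(X, ℂ) →⋆ₐ[ℂ] A), Function.Injective ρ ∧ s ⊆ Set.range ρ := by
  have := StarAlgebra.isMulCommutative_adjoin ℂ hs hs'
  let S := (StarAlgebra.adjoin ℂ s).topologicalClosure
  have : IsClosed (S : Set A) := (StarAlgebra.adjoin ℂ s).isClosed_topologicalClosure
  let : CommCStarAlgebra S :=
    { (inferInstance : CStarAlgebra S) with
      mul_comm := ((StarAlgebra.adjoin ℂ s).commRingTopologicalClosure mul_comm').mul_comm }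
  let Γ := gelfandStarTransform S
  refine ⟨WeakDual.characterSpace ℂ S, inferInstance, inferInstance, inferInstance,
    S.subtype.comp (Γ.symm : C(WeakDual.characterSpace ℂ S, ℂ) →⋆ₐ[ℂ] S),
    Subtype.val_injective.comp Γ.symm.injective, fun a ha => ?_⟩
  have haS : a ∈ S := (StarAlgebra.adjoin ℂ s).le_topologicalClosure
    (StarAlgebra.subset_adjoin ℂ s ha)
  exact ⟨Γ ⟨a, haS⟩, congrArg Subtype.val (Γ.symm_apply_apply ⟨a, haS⟩)⟩

section Resolvent

variable {H : Type*} [NormedAddCommGroup H] [InnerProductSpace ℂ H] [CompleteSpace H]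
variable {N : H →ₗ.[ℂ] H} {B C : H →L[ℂ] H}

theorem mem_adjoint_graph_iff (hd : Dense (N.domain : Set H)) {y z : H} :
    (y, z) ∈ N†.graph ↔ ∀ a b, (a, b) ∈ N.graph → ⟪b, y⟫_ℂ = ⟪a, z⟫_ℂ := by
  rw [LinearPMap.adjoint_graph_eq_graph_adjoint hd, Submodule.mem_adjoint_iff]
  simp only [sub_eq_zero]

variable (N B C) in
/-- `B = (1 + N* N)⁻¹` and `C = N (1 + N* N)⁻¹`: the pair of bounded operators through which the
unbounded operator `N` is studied. -/
def IsResolventPair : Prop :=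
  ∀ h, (B h, C h) ∈ N.graph ∧ (C h, h - B h) ∈ N†.graph

/-- The pair `(B h, C h)` is the orthogonal projection of `(h, 0)` onto the graph of `N`. -/
theorem exists_isResolventPair (hd : Dense (N.domain : Set H)) (hc : N.IsClosed) :
    ∃ B C : H →L[ℂ] H, IsResolventPair N B C := by
  let e := WithLp.prodContinuousLinearEquiv 2 ℂ H H
  let G : Submodule ℂ (WithLp 2 (H × H)) := N.graph.comap (e : WithLp 2 (H × H) →ₗ[ℂ] H × H)
  have hG : IsClosed (G : Set (WithLp 2 (H × H))) := IsClosed.preimage e.continuous hc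
  have : CompleteSpace G := hG.completeSpace_coe
  let P : H →L[ℂ] H × H := (e : WithLp 2 (H × H) →L[ℂ] H × H) ∘L G.starProjection ∘L
    (e.symm : H × H →L[ℂ] WithLp 2 (H × H)) ∘L ContinuousLinearMap.inl ℂ H H
  refine ⟨ContinuousLinearMap.fst ℂ H H ∘L P, ContinuousLinearMap.snd ℂ H H ∘L P, fun h =>
    ⟨Submodule.starProjection_apply_mem G (e.symm (h, 0)), ?_⟩⟩
  refine (mem_adjoint_graph_iff hd).2 fun a b hab => ?_
  have horth : ⟪a, h - (P h).1⟫_ℂ + ⟪b, 0 - (P h).2⟫_ℂ = 0 :=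
    (Submodule.mem_orthogonal G _).1
      (Submodule.sub_starProjection_mem_orthogonal (K := G) (e.symm (h, 0))) (e.symm (a, b)) hab
  rw [zero_sub, inner_neg_right, add_neg_eq_zero] at horth
  exact horth.symm

namespace IsResolventPair

section Basic

variable (hBC : IsResolventPair N B C)
include hBC

theorem injective : Function.Injective B := by
  refine (injective_iff_map_eq_zero B).2 fun h hh => ?_
  obtain ⟨h₁, h₂⟩ := hBC h
  have hC : C h = 0 := N.graph_fst_eq_zero_snd h₁ hh
  simpa only [hh, sub_zero] using N†.graph_fst_eq_zero_snd h₂ hC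

variable (hd : Dense (N.domain : Set H))
include hd

theorem apply_add_eq {x y z : H} (hxy : (x, y) ∈ N.graph) (hyz : (y, z) ∈ N†.graph) :
    B (x + z) = x := by
  have h₁ := N.graph.sub_mem hxy (hBC (x + z)).1
  have h₂ := N†.graph.sub_mem hyz (hBC (x + z)).2
  rw [Prod.mk_sub_mk] at h₁ h₂
  have hinner := (mem_adjoint_graph_iff hd).1 h₂ _ _ h₁
  rw [show z - (x + z - B (x + z)) = -(x - B (x + z)) by abel, inner_neg_right,
    inner_self_eq_norm_sq_to_K, inner_self_eq_norm_sq_to_K] at hinner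
  have hsq : ‖y - C (x + z)‖ ^ 2 = -‖x - B (x + z)‖ ^ 2 := by exact_mod_cast hinner
  have hzero : ‖x - B (x + z)‖ = 0 := by
    nlinarith only [hsq, sq_nonneg ‖y - C (x + z)‖, sq_nonneg ‖x - B (x + z)‖]
  exact (sub_eq_zero.1 (norm_eq_zero.1 hzero)).symm

theorem inner_apply_left (h k : H) : ⟪B h, k⟫_ℂ = ⟪B h, B k⟫_ℂ + ⟪C h, C k⟫_ℂ := by
  rw [(mem_adjoint_graph_iff hd).1 (hBC k).2 _ _ (hBC h).1, ← inner_add_right, add_sub_cancel]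

theorem isSymmetric : (B : H →ₗ[ℂ] H).IsSymmetric := fun h k => by
  change ⟪B h, k⟫_ℂ = ⟪h, B k⟫_ℂ
  rw [← inner_conj_symm h (B k), hBC.inner_apply_left hd h k, hBC.inner_apply_left hd k h, map_add,
    inner_conj_symm, inner_conj_symm]

theorem star_eq_self : star B = B :=
  ContinuousLinearMap.isSelfAdjoint_iff_isSymmetric.2 (hBC.isSymmetric hd)

theorem star_mul_self : star C * C = B - B * B := by
  ext k
  refine ext_inner_left ℂ fun h => ?_
  calc ⟪h, ContinuousLinearMap.adjoint C (C k)⟫_ℂ = ⟪C h, C k⟫_ℂ :=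
        ContinuousLinearMap.adjoint_inner_right ..
    _ = ⟪B h, k⟫_ℂ - ⟪B h, B k⟫_ℂ := by rw [hBC.inner_apply_left hd h k, add_sub_cancel_left]
    _ = ⟪h, B k⟫_ℂ - ⟪h, B (B k)⟫_ℂ :=
        congrArg₂ _ (hBC.isSymmetric hd h k) (hBC.isSymmetric hd h (B k))
    _ = ⟪h, B k - B (B k)⟫_ℂ := (inner_sub_right ..).symm

end Basic

variable (hBC : IsResolventPair N B C) (hN : IsNormalOperator N)
include hBC hN

theorem apply_snd_eq {x y : H} (hxy : (x, y) ∈ N.graph) : B y = C x := by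
  have hsub := N.graph.sub_mem hxy (hBC x).1
  rw [Prod.mk_sub_mk] at hsub
  obtain ⟨w, hw₁, hw₂⟩ := (hN.comm (C x) (y - C x)).2 ⟨x - B x, (hBC x).2, hsub⟩
  simpa only [add_sub_cancel] using hBC.apply_add_eq hN.dense_domain hw₁ hw₂

theorem mul_comm : B * C = C * B := by
  ext h
  exact hBC.apply_snd_eq hN (hBC h).1

theorem mul_star_comm : B * star C = star C * B := by
  have h := congrArg star (hBC.mul_comm hN)
  rw [star_mul, star_mul, hBC.star_eq_self hN.dense_domain] at h
  exact h.symm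

theorem star_apply_mem_graph (h : H) : (star C h, h - B h) ∈ N.graph := by
  obtain ⟨w, hw₁, hw₂⟩ := (hN.comm (B h) (h - B h)).1 ⟨C h, hBC h⟩
  have hw : w = star C h := hN.dense_domain.eq_of_inner_right ℂ fun k hk => by
    have hk' : (k, N ⟨k, hk⟩) ∈ N.graph := N.mem_graph ⟨k, hk⟩
    calc ⟪k, w⟫_ℂ = ⟪N ⟨k, hk⟩, B h⟫_ℂ :=
          ((mem_adjoint_graph_iff hN.dense_domain).1 hw₁ _ _ hk').symm
      _ = ⟪B (N ⟨k, hk⟩), h⟫_ℂ := (hBC.isSymmetric hN.dense_domain _ h).symm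
      _ = ⟪C k, h⟫_ℂ := by rw [hBC.apply_snd_eq hN hk']
      _ = ⟪k, star C h⟫_ℂ := (ContinuousLinearMap.adjoint_inner_right C k h).symm
  rwa [← hw]

theorem mul_star_self : C * star C = B - B * B := by
  ext h
  change C (star C h) = B h - B (B h)
  rw [← hBC.apply_snd_eq hN (hBC.star_apply_mem_graph hN h), map_sub]

theorem mem_graph_iff {x v : H} : (x, v) ∈ N.graph ↔ B v = C x := by
  refine ⟨hBC.apply_snd_eq hN, fun h => ?_⟩
  have hstar : star C v = x - B x := hBC.injective <|
    calc B (star C v) = star C (B v) :=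
          congrArg (fun T : H →L[ℂ] H => T v) (hBC.mul_star_comm hN)
      _ = (star C * C) x := by rw [h]; rfl
      _ = B (x - B x) := by rw [hBC.star_mul_self hN.dense_domain, map_sub]; rfl
  have hmem := N.graph.add_mem (hBC.star_apply_mem_graph hN v) (hBC x).1
  rwa [hstar, h, Prod.mk_add_mk, sub_add_cancel, sub_add_cancel] at hmem

end IsResolventPair

end Resolvent

section SpectralTheorem

variable {H : Type u} [NormedAddCommGroup H] [InnerProductSpace ℂ H] [CompleteSpace H]

namespace IsResolventPair

theorem exists_continuousMap_representation {N : H →ₗ.[ℂ] H} {B C : H →L[ℂ] H}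
    (hBC : IsResolventPair N B C) (hN : IsNormalOperator N) :
    ∃ (X : Type u) (_ : TopologicalSpace X) (_ : T2Space X) (_ : CompactSpace X)
      (ρ : C(X, ℂ) →⋆ₐ[ℂ] (H →L[ℂ] H)) (b c : C(X, ℂ)),
      ρ b = B ∧ ρ c = C ∧ star c * c = b - b * b := by
  have hB := hBC.star_eq_self hN.dense_domain
  have hCC := hBC.star_mul_self hN.dense_domain
  have hcomm : ∀ S ∈ ({B, C} : Set (H →L[ℂ] H)), ∀ T ∈ ({B, C} : Set (H →L[ℂ] H)),
      S * T = T * S := by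
    rintro S (rfl | rfl) T (rfl | rfl)
    exacts [rfl, hBC.mul_comm hN, (hBC.mul_comm hN).symm, rfl]
  have hcomm_star : ∀ S ∈ ({B, C} : Set (H →L[ℂ] H)), ∀ T ∈ ({B, C} : Set (H →L[ℂ] H)),
      S * star T = star T * S := by
    rintro S (rfl | rfl) T (rfl | rfl)
    · rw [hB]
    · exact hBC.mul_star_comm hN
    · rw [hB, hBC.mul_comm hN]
    · exact (hBC.mul_star_self hN).trans hCC.symm
  obtain ⟨X, _, _, _, ρ, hρ, hrange⟩ := _root_.exists_continuousMap_representation hcomm hcomm_star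
  obtain ⟨b, hb⟩ := hrange (Set.mem_insert B {C})
  obtain ⟨c, hc⟩ := hrange (Set.mem_insert_of_mem B rfl)
  have hbc : star c * c = b - b * b :=
    hρ (by simp only [map_mul, map_star, map_sub, hb, hc, hCC])
  exact ⟨X, _, ‹_›, ‹_›, ρ, b, c, hb, hc, hbc⟩

end IsResolventPair

open BorelCalculus in
/-- `N` is the function `C / B` of its resolvent pair. -/
theorem IsNormalOperator.exists_spectralMeasure {N : H →ₗ.[ℂ] H} (hN : IsNormalOperator N) :
    ∃ E : SpectralMeasure H, N = E.integral (fun z => z) measurable_id := by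
  obtain ⟨B, C, hBC⟩ := exists_isResolventPair hN.dense_domain hN.isClosed
  obtain ⟨X, _, _, _, ρ, b, c, rfl, rfl, hbc⟩ := hBC.exists_continuousMap_representation hN
  let : MeasurableSpace X := borel X
  have : BorelSpace X := ⟨rfl⟩
  let π : X → ℂ := ⇑c / ⇑b
  have hπ : Measurable π := c.continuous.measurable.div b.continuous.measurable
  have hbπ : ⇑b * π = ⇑c := funext fun t => by
    refine mul_div_cancel_of_imp' fun hb => ?_
    simpa [hb] using DFunLike.congr_fun hbc t
  have hmap {x : H} (hx : MemLp π 2 (vectorMeasure ρ x)) : ρ b (borelVec ρ π x) = ρ c x := by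
    rw [map_borelVec b hx, hbπ, borelVec_coe]
  refine ⟨spectralMeasure ρ π hπ, LinearPMap.eq_of_eq_graph (Submodule.ext fun ⟨x, v⟩ => ?_)⟩
  rw [hBC.mem_graph_iff hN, LinearPMap.mem_graph_iff]
  constructor
  · intro h
    have hx : MemLp π 2 (vectorMeasure ρ x) := memLp_div_of_map_eq h
    refine ⟨⟨x, (mem_integral_spectralMeasure_domain hπ measurable_id).2 hx⟩, rfl, ?_⟩
    exact (integral_spectralMeasure hπ measurable_id _).trans
      (hBC.injective ((hmap hx).trans h.symm))
  · rintro ⟨x', rfl, rfl⟩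
    have hx := (mem_integral_spectralMeasure_domain hπ measurable_id).1 x'.2
    exact (congrArg (ρ b) (integral_spectralMeasure hπ measurable_id x')).trans (hmap hx)

end SpectralTheorem

/-! ### Hölder functions of normal operators -/

theorem MemHolderClass.holderWith {α : ℝ≥0} {f : ℂ → ℂ} (hf : MemHolderClass α f) :
    HolderWith (holderSeminorm α f).toNNReal α f := fun z w => by
  rw [ENNReal.coe_toNNReal hf.ne]
  rcases eq_or_ne z w with rfl | hzw
  · rw [edist_self]
    exact zero_le
  · have hpos : 0 < ‖z - w‖ := norm_sub_pos_iff.2 hzw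
    have hle : ENNReal.ofReal (‖f z - f w‖ / ‖z - w‖ ^ (α : ℝ)) ≤ holderSeminorm α f :=
      le_iSup_of_le z (le_iSup_of_le w (le_iSup_of_le hzw le_rfl))
    rw [ENNReal.ofReal_div_of_pos (Real.rpow_pos_of_pos hpos _),
      ← ENNReal.ofReal_rpow_of_pos hpos] at hle
    rw [edist_dist, edist_dist, dist_eq_norm, dist_eq_norm]
    refine (ENNReal.div_le_iff ?_ ?_).1 hle
    · exact (ENNReal.rpow_pos (ENNReal.ofReal_pos.2 hpos) ENNReal.ofReal_ne_top).ne'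
    · exact ENNReal.rpow_ne_top_of_nonneg α.2 ENNReal.ofReal_ne_top

variable {H : Type*} [NormedAddCommGroup H] [InnerProductSpace ℂ H] [CompleteSpace H]

namespace SpectralMeasure

theorem opNormSub_integral_const (E₁ E₂ : SpectralMeasure H) {f : ℂ → ℂ} (hf : Measurable f) {c : ℂ}
    (hc : ∀ z, f z = c) : opNormSub (E₁.integral f hf) (E₂.integral f hf) = 0 := by
  have hdom (E : SpectralMeasure H) : (E.integral f hf).domain = ⊤ := eq_top_iff.2 fun x _ => by
    rw [mem_integral_domain, funext hc]
    exact memLp_const c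
  have hval (E : SpectralMeasure H) {x y : H} (hy : (x, y) ∈ (E.integral f hf).graph) :
      y = c • x := by
    obtain ⟨x, rfl, rfl⟩ := (LinearPMap.mem_graph_iff _).1 hy
    have h := E.proj_integral_of_eqOn hf MeasurableSet.univ (fun z _ => hc z) x
    simpa only [E.proj_univ, one_apply_eq_self] using h
  rw [← nonpos_iff_eq_zero, ← ENNReal.ofReal_zero, opNormSub_le_ofReal_iff le_rfl]
  refine ⟨(hdom E₁).trans (hdom E₂).symm, fun x y z hy hz => ?_⟩
  rw [hval E₁ hy, hval E₂ hz, sub_self, norm_zero, zero_mul]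

theorem opNormSub_integral_holder_le_of_ne_top {E₁ E₂ : SpectralMeasure H} {α L : ℝ≥0} {f : ℂ → ℂ}
    (hf : Measurable f) (hfL : HolderWith L α f) (hα : α < 1) {d : ℝ≥0∞}
    (hd : opNormSub (E₁.integral (fun z => z) measurable_id)
      (E₂.integral (fun z => z) measurable_id) = d) (hd_top : d ≠ ∞) :
    opNormSub (E₁.integral f hf) (E₂.integral f hf) ≤
      ENNReal.ofReal (244 * (1 - α : ℝ)⁻¹ * (L * d.toReal ^ (α : ℝ))) := by
  have hcont : Continuous fun δ : ℝ =>
      ENNReal.ofReal (244 * (1 - α : ℝ)⁻¹ * (L * δ ^ (α : ℝ))) :=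
    ENNReal.continuous_ofReal.comp (continuous_const.mul (continuous_const.mul
      (Real.continuous_rpow_const α.2)))
  have hlim := (hcont.tendsto d.toReal).mono_left (nhdsWithin_le_nhds (s := Set.Ioi d.toReal))
  refine ge_of_tendsto hlim ?_
  filter_upwards [self_mem_nhdsWithin] with δ (hδ : d.toReal < δ)
  have hδ₀ : 0 < δ := ENNReal.toReal_nonneg.trans_lt hδ
  have hdδ : d ≤ ENNReal.ofReal δ := (ENNReal.le_ofReal_iff_toReal_le hd_top hδ₀.le).2 hδ.le
  lift δ to ℝ≥0 using hδ₀.le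
  exact opNormSub_integral_holder_le hf hfL (by exact_mod_cast hδ₀) hα (hd.trans_le hdδ)

theorem opNormSub_integral_holderSeminorm_le (E₁ E₂ : SpectralMeasure H) {α : ℝ≥0} (hα₀ : 0 < α)
    (hα₁ : α < 1) {f : ℂ → ℂ} (hf : Measurable f) (hfα : MemHolderClass α f) :
    opNormSub (E₁.integral f hf) (E₂.integral f hf) ≤
      ENNReal.ofReal (244 * (1 - α : ℝ)⁻¹) * holderSeminorm α f *
        opNormSub (E₁.integral (fun z => z) measurable_id)
          (E₂.integral (fun z => z) measurable_id) ^ (α : ℝ) := by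
  generalize hd : opNormSub (E₁.integral (fun z => z) measurable_id)
    (E₂.integral (fun z => z) measurable_id) = d
  have hα : 0 < 244 * (1 - α : ℝ)⁻¹ := mul_pos (by norm_num) (inv_pos.2 (sub_pos.2 (by simpa)))
  have hfL := hfα.holderWith
  rcases eq_or_ne (holderSeminorm α f) 0 with hL | hL
  · rw [hL, ENNReal.toNNReal_zero] at hfL
    rw [opNormSub_integral_const E₁ E₂ hf fun z => edist_le_zero.1 (by simpa using hfL z 0)]
    exact zero_le
  rcases eq_or_ne d ∞ with rfl | hd_top
  · rw [ENNReal.top_rpow_of_pos (by simpa), ENNReal.mul_top]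
    · exact le_top
    · exact mul_ne_zero (ENNReal.ofReal_pos.2 hα).ne' hL
  refine (opNormSub_integral_holder_le_of_ne_top hf hfL hα₁ hd hd_top).trans_eq ?_
  rw [ENNReal.ofReal_mul hα.le, ENNReal.ofReal_mul (NNReal.coe_nonneg _),
    ← ENNReal.ofReal_rpow_of_nonneg ENNReal.toReal_nonneg α.coe_nonneg,
    ENNReal.ofReal_toReal hd_top, ENNReal.ofReal_coe_nnreal, ENNReal.coe_toNNReal hfα.ne, mul_assoc]

end SpectralMeasure

theorem IsNormalOperator.exists_borelFunction_eq {N : H →ₗ.[ℂ] H} (hN : IsNormalOperator N) :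
    ∃ E : SpectralMeasure H, N = E.integral (fun z => z) measurable_id ∧
      ∀ f hf, borelFunction N f hf = E.integral f hf :=
  ⟨hN.exists_spectralMeasure.choose, hN.exists_spectralMeasure.choose_spec,
    fun _ _ => dif_pos hN.exists_spectralMeasure⟩

end

theorem theorem8p1 :
    ∃ c : ℝ, 0 < c ∧
      ∀ (H : Type*) [NormedAddCommGroup H] [InnerProductSpace ℂ H] [CompleteSpace H]
        (α : ℝ) (hα₀ : 0 < α) (_hα₁ : α < 1)
        (f : ℂ → ℂ) (hf : MemHolderClass α f)
        (N₁ N₂ : H →ₗ.[ℂ] H), IsNormalOperator N₁ → IsNormalOperator N₂ →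
        opNormSub (borelFunction N₁ f (hf.measurable hα₀))
            (borelFunction N₂ f (hf.measurable hα₀)) ≤
          ENNReal.ofReal (c * (1 - α)⁻¹) * holderSeminorm α f * opNormSub N₁ N₂ ^ α := by
  refine ⟨244, by norm_num, fun H _ _ _ α hα₀ hα₁ f hf N₁ N₂ hN₁ hN₂ => ?_⟩
  obtain ⟨E₁, h₁, hf₁⟩ := hN₁.exists_borelFunction_eq
  obtain ⟨E₂, h₂, hf₂⟩ := hN₂.exists_borelFunction_eq
  rw [hf₁, hf₂, h₁, h₂]
  lift α to NNReal using hα₀.le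
  exact E₁.opNormSub_integral_holderSeminorm_le E₂ (by exact_mod_cast hα₀) (by exact_mod_cast hα₁)
    (hf.measurable hα₀) hf
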